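/- **Theorem (nonconvex convergence of Local Exact-Diffusion, LED).** There are absolute constants $c,C>0$ such that the following holds. *Setting.* Let $N,\tau\ge 1$ and let $W=[w_{ij}]\in\mathbb R^{N\times N}$ be symmetric, doubly stochastic, primitive and positive definite, with mixing rate $\lambda=\|W-\frac1N\mathbf 1\mathbf 1^{\mathsf T}\|<1$ (spectral norm) and smallest eigenvalue $\underline\lambda>0$. Let $f_1,\dots,f_N:\mathbb R^m\to\mathbb R$ be differentiable with $\|\nabla f_i(y)-\nabla f_i(z)\|\le L\|y-z\|$ for all $y,z$, where $L>0$, and let $f=\frac1N\sum_i f_i$ be bounded below, with $f^\star=\inf f$. *Algorithm.* Given (deterministic) $x_1^0,\dots,x_N^0\in\mathbb R^m$, put $y_i^0=x_i^0-\sum_j w_{ij}x_j^0$ for all $i$ (or $y_i^0=0$ for all $i$). For $r=0,1,2,\dots$ let $\phi_{i,0}^r=x_i^r$, $$\phi_{i,t+1}^r=\phi_{i,t}^r-\alpha\nabla F_i(\phi_{i,t}^r;\xi_{i,t}^r)-\beta y_i^r\quad(0\le t<\tau),\qquad x_i^{r+1}=\sum_j w_{ij}\phi_{j,\tau}^r,\qquad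 y_i^{r+1}=y_i^r+\phi_{i,\tau}^r-x_i^{r+1},$$ with $\beta=1/\tau$. The random data $\xi_{i,t}^r$ are mutually independent and, conditionally on all iterates up to local step $t$ of round $r$, each stochastic gradient satisfies $\mathbb E[\nabla F_i(\phi_{i,t}^r;\xi_{i,t}^r)-\nabla f_i(\phi_{i,t}^r)\mid\cdot\,]=0$ and $\mathbb E[\|\nabla F_i(\phi_{i,t}^r;\xi_{i,t}^r)-\nabla f_i(\phi_{i,t}^r)\|^2\mid\cdot\,]\le\sigma^2$. *Conclusion.* Write $\bar x^r=\frac1N\sum_i x_i^r$, $\varsigma_0^2=\frac1N\sum_i\|\nabla f_i(\bar x^0)-\nabla f(\bar x^0)\|^2$ and $$\mathcal E_r=\mathbb E\Big[\|\nabla f(\bar x^r)\|^2+\frac1\tau\sum_{t=0}^{\tau-1}\Big\|\frac1N\sum_{i=1}^N\nabla f_i(\phi_{i,t}^r)\Big\|^2\Big].$$ If $0<\alpha\le c\,\frac{1-\lambda}{\tau L}$, then every $\mathcal E_r$ is finite, and if all nodes start from the same point ($x_1^0=\dots=x_N^0$), then for every $R\ge1$ $$\frac1R\sum_{r=0}^{R-1}\mathcal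 E_r\le C\left(\frac{f(\bar x^0)-f^\star}{\alpha\tau R}+\frac{\alpha^2\tau^2L^2\varsigma_0^2}{(1-\lambda)^2R}+\frac{\alpha L\sigma^2}{N}+\frac{\alpha^2\tau L^2\sigma^2}{1-\lambda}\right).$$ For arbitrary $x_1^0,\dots,x_N^0$ the same holds with the term $\dfrac{L^2\sum_{i}\|x_i^0-\bar x^0\|^2}{(1-\lambda)\,\underline\lambda\,N R}$ added inside the bracket. -/

import Mathlib

open MeasureTheory ProbabilityTheory
open scoped Gradient

namespace LED

/-- The decision space `ℝ^m` with the Euclidean norm. -/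
abbrev Vec (m : ℕ) := EuclideanSpace ℝ (Fin m)

/-! ### The network -/

/-- Weight matrix assumption: symmetric, doubly stochastic, primitive, positive definite. -/
structure IsWeightMatrix {N : ℕ} (W : Matrix (Fin N) (Fin N) ℝ) : Prop where
  symm : W.IsSymm
  doublyStochastic : W ∈ doublyStochastic ℝ (Fin N)
  primitive : W.IsPrimitive
  posDef : W.PosDef

/-- The mixing rate `λ = ‖W - (1/N) 𝟙𝟙ᵀ‖` (spectral norm). -/
noncomputable def mixingRate {N : ℕ} (W : Matrix (Fin N) (Fin N) ℝ) : ℝ :=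
  ‖Matrix.toEuclideanCLM (n := Fin N) (𝕜 := ℝ) (W - Matrix.of fun _ _ => 1 / (N : ℝ))‖

/-- The smallest eigenvalue of `W`. -/
noncomputable def minEigenvalue {N : ℕ} (W : Matrix (Fin N) (Fin N) ℝ) : ℝ :=
  sInf (spectrum ℝ W)

/-! ### Averages and heterogeneity -/

/-- The average `(1/N) ∑ᵢ uᵢ`. -/
noncomputable def avg {N m : ℕ} (u : Fin N → Vec m) : Vec m :=
  (1 / (N : ℝ)) • ∑ i, u i

/-- The aggregate objective `f(x) = (1/N) ∑ᵢ fᵢ(x)`. -/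
noncomputable def aggregate {N m : ℕ} (f : Fin N → Vec m → ℝ) (x : Vec m) : ℝ :=
  (1 / (N : ℝ)) * ∑ i, f i x

/-- `ς₀² = (1/N) ∑ᵢ ‖∇fᵢ(x̄) - ∇f(x̄)‖²`. -/
noncomputable def heterogeneity {N m : ℕ} (f : Fin N → Vec m → ℝ) (x : Vec m) : ℝ :=
  (1 / (N : ℝ)) * ∑ i, ‖∇ (f i) x - ∇ (aggregate f) x‖ ^ 2

/-- The disagreement `∑ᵢ ‖uᵢ - ū‖²`. -/
noncomputable def disagreement {N m : ℕ} (u : Fin N → Vec m) : ℝ :=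
  ∑ i, ‖u i - avg u‖ ^ 2

/-- Objective assumption: each `fᵢ` is differentiable with `L`-Lipschitz gradient, `L > 0`, and the
aggregate is bounded below. -/
structure IsSmoothObjective {N m : ℕ} (f : Fin N → Vec m → ℝ) (L : ℝ) : Prop where
  pos : 0 < L
  differentiable : ∀ i, Differentiable ℝ (f i)
  lipschitz : ∀ i y z, ‖∇ (f i) y - ∇ (f i) z‖ ≤ L * ‖y - z‖
  bddBelow : BddBelow (Set.range (aggregate f))

/-! ### Local Exact-Diffusion along one sample path

`G i x s` is the stochastic gradient `∇Fᵢ(x; s)` of node `i` at the point `x` with data `s`, and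
`ξ r t i` is the datum drawn by node `i` at local step `t` of round `r`. -/

section Algorithm

variable {N m : ℕ} {Ξ : Type*}

/-- The local updates of one round:
`φ_{i,0} = xᵢ` and `φ_{i,t+1} = φ_{i,t} - α ∇Fᵢ(φ_{i,t}; ξ_{i,t}) - β yᵢ`. -/
noncomputable def localUpdates (G : Fin N → Vec m → Ξ → Vec m) (α β : ℝ) (ξ : ℕ → Fin N → Ξ)
    (x y : Fin N → Vec m) : ℕ → Fin N → Vec m
  | 0 => x
  | t + 1 => fun i =>
      localUpdates G α β ξ x y t i
        - α • G i (localUpdates G α β ξ x y t i) (ξ t i) - β • y i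

/-- The pair `(x^r, y^r)` after `r` communication rounds:
`xᵢ^{r+1} = ∑ⱼ wᵢⱼ φ_{j,τ}^r` and `yᵢ^{r+1} = yᵢ^r + φ_{i,τ}^r - xᵢ^{r+1}`. -/
noncomputable def state (W : Matrix (Fin N) (Fin N) ℝ) (G : Fin N → Vec m → Ξ → Vec m)
    (τ : ℕ) (α β : ℝ) (x₀ y₀ : Fin N → Vec m) (ξ : ℕ → ℕ → Fin N → Ξ) :
    ℕ → (Fin N → Vec m) × (Fin N → Vec m)
  | 0 => (x₀, y₀)
  | r + 1 =>
      let x := (state W G τ α β x₀ y₀ ξ r).1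
      let y := (state W G τ α β x₀ y₀ ξ r).2
      let φ := localUpdates G α β (ξ r) x y τ
      let x' : Fin N → Vec m := fun i => ∑ j, W i j • φ j
      (x', fun i => y i + φ i - x' i)

/-- The local iterate `φ_{i,t}^r`. -/
noncomputable def phi (W : Matrix (Fin N) (Fin N) ℝ) (G : Fin N → Vec m → Ξ → Vec m)
    (τ : ℕ) (α β : ℝ) (x₀ y₀ : Fin N → Vec m) (ξ : ℕ → ℕ → Fin N → Ξ) (r t : ℕ) :
    Fin N → Vec m :=
  localUpdates G α β (ξ r) (state W G τ α β x₀ y₀ ξ r).1 (state W G τ α β x₀ y₀ ξ r).2 t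

/-- The random quantity `‖∇f(x̄^r)‖² + (1/τ) ∑_{t<τ} ‖(1/N) ∑ᵢ ∇fᵢ(φ_{i,t}^r)‖²`, whose
expectation is `𝓔_r`. -/
noncomputable def errorTerm (W : Matrix (Fin N) (Fin N) ℝ) (f : Fin N → Vec m → ℝ)
    (G : Fin N → Vec m → Ξ → Vec m) (τ : ℕ) (α β : ℝ) (x₀ y₀ : Fin N → Vec m)
    (ξ : ℕ → ℕ → Fin N → Ξ) (r : ℕ) : ℝ :=
  ‖∇ (aggregate f) (avg (state W G τ α β x₀ y₀ ξ r).1)‖ ^ 2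
    + (1 / (τ : ℝ)) * ∑ t ∈ Finset.range τ,
        ‖avg fun i => ∇ (f i) (phi W G τ α β x₀ y₀ ξ r t i)‖ ^ 2

end Algorithm

/-! ### Random data and the noise assumption -/

section Noise

variable {N m : ℕ} {Ξ Ω : Type*}

/-- The sample path of the data at the outcome `ω`. -/
def path (ξ : ℕ → ℕ → Fin N → Ω → Ξ) (ω : Ω) : ℕ → ℕ → Fin N → Ξ :=
  fun r t i => ξ r t i ω

/-- The σ-algebra generated by the iterates of all nodes up to local step `t` of round `r`. -/
@[reducible] noncomputable def past (W : Matrix (Fin N) (Fin N) ℝ) (G : Fin N → Vec m → Ξ → Vec m)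
    (τ : ℕ) (α β : ℝ) (x₀ y₀ : Fin N → Vec m) (ξ : ℕ → ℕ → Fin N → Ω → Ξ) (r t : ℕ) :
    MeasurableSpace Ω :=
  ⨆ (q : ℕ) (s : ℕ) (_ : (q < r ∧ s ≤ τ) ∨ (q = r ∧ s ≤ t)) (j : Fin N),
    MeasurableSpace.comap (fun ω => phi W G τ α β x₀ y₀ (path ξ ω) q s j) inferInstance

/-- The gradient noise `∇Fᵢ(φ_{i,t}^r; ξ_{i,t}^r) - ∇fᵢ(φ_{i,t}^r)`. -/
noncomputable def noise (W : Matrix (Fin N) (Fin N) ℝ) (f : Fin N → Vec m → ℝ)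
    (G : Fin N → Vec m → Ξ → Vec m) (τ : ℕ) (α β : ℝ) (x₀ y₀ : Fin N → Vec m)
    (ξ : ℕ → ℕ → Fin N → Ω → Ξ) (r t : ℕ) (i : Fin N) (ω : Ω) : Vec m :=
  G i (phi W G τ α β x₀ y₀ (path ξ ω) r t i) (ξ r t i ω)
    - ∇ (f i) (phi W G τ α β x₀ y₀ (path ξ ω) r t i)

/-- Noise assumption: the data are mutually independent; conditionally on all iterates so far, each
stochastic gradient used by the algorithm is unbiased with variance at most `σ²`. (The field `memLp`
only makes the conditional expectations genuine ones.) -/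
structure IsBoundedNoise [MeasurableSpace Ξ] [MeasurableSpace Ω] (μ : Measure Ω)
    (W : Matrix (Fin N) (Fin N) ℝ) (f : Fin N → Vec m → ℝ)
    (G : Fin N → Vec m → Ξ → Vec m) (τ : ℕ) (α β : ℝ) (x₀ y₀ : Fin N → Vec m)
    (ξ : ℕ → ℕ → Fin N → Ω → Ξ) (σ : ℝ) : Prop where
  measurable_grad : ∀ i, Measurable fun p : Vec m × Ξ => G i p.1 p.2
  measurable_data : ∀ r t i, t < τ → Measurable (ξ r t i)
  indep : iIndepFun (fun p : ℕ × Fin τ × Fin N => ξ p.1 p.2.1 p.2.2) μ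
  memLp : ∀ r t i, t < τ → MemLp (noise W f G τ α β x₀ y₀ ξ r t i) 2 μ
  unbiased : ∀ r t i, t < τ →
    μ[noise W f G τ α β x₀ y₀ ξ r t i | past W G τ α β x₀ y₀ ξ r t] =ᵐ[μ] 0
  variance_le : ∀ r t i, t < τ →
    μ[fun ω => ‖noise W f G τ α β x₀ y₀ ξ r t i ω‖ ^ 2 | past W G τ α β x₀ y₀ ξ r t]
      ≤ᵐ[μ] fun _ => σ ^ 2

end Noise

/-! ### The bound -/

/-- `(f(x̄⁰) - f⋆)/(ατR) + α²τ²L²ς₀²/((1-λ)²R) + αLσ²/N + α²τL²σ²/(1-λ)`, where `f⋆ = inf f`. -/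
noncomputable def rate {N m : ℕ} (W : Matrix (Fin N) (Fin N) ℝ) (f : Fin N → Vec m → ℝ)
    (L σ : ℝ) (τ : ℕ) (α : ℝ) (x₀ : Fin N → Vec m) (R : ℕ) : ℝ :=
  (aggregate f (avg x₀) - ⨅ x, aggregate f x) / (α * τ * R)
    + α ^ 2 * τ ^ 2 * L ^ 2 * heterogeneity f (avg x₀) / ((1 - mixingRate W) ^ 2 * R)
    + α * L * σ ^ 2 / N
    + α ^ 2 * τ * L ^ 2 * σ ^ 2 / (1 - mixingRate W)

end LED

/-! The average of the nodes follows stochastic gradient descent: `W` preserves averages and the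
dual variables sum to zero, so a round moves the average by `-α` times the sum of the averaged
stochastic gradients. Smoothness of the aggregate then yields a decrease of `ατ/4` times the
stationarity measure (`IsRound.descent`), up to noise and to the drift of the local iterates, which
`IsRound.drift_le` controls by the consensus error, the gradient and the noise.

The consensus error is handled through the deviation `z i = y i + ατ ∇fᵢ(x̄)` of the dual variable
from the value that cancels the local gradient over a round; this is why heterogeneity enters only
through the initial value. In an eigenbasis of `W`, the coordinates `(p, q)` of `(x, z)` in a mode
of eigenvalue `d ≠ 1` follow the map `(p, q) ↦ (d(p - q), dq + (1 - d)p)`, and `‖p‖² + (1 + d)/(2(1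
- d)) ‖q‖²` contracts by `(1 + d)/2` (`mode_contraction`). Three perturbations remain: gradient
differences along the local steps, the motion of the target with `x̄`, and noise. For `ατL ≤ (1 -
λ)/32` the first two leave a contraction plus a small multiple of stationarity
(`IsRound.lyapunov_step`). Telescoping both recursions and absorbing that multiple gives
`sum_stationarity_le` on every sample path.

The pathwise inequalities keep the terms linear in the noise that pair it with quantities fixed at
the start of the round; these have mean zero. The quadratic terms need noises at different steps or
nodes to be orthogonal. Two nodes at the same step are not covered by conditioning on the past, so
orthogonality is derived from independence of the data (`integral_inner_eq_zero_of_indep`). It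
produces the factor `1/N` in the leading noise term. -/

namespace LED

/-! ### Spectral coordinates of the weight matrix -/

/-- An orthonormal eigenbasis `Q` of the weight matrix with eigenvalues `d`, in which the consensus
direction is separated from the others. -/
structure IsSpectralBasis {N : ℕ} (W : Matrix (Fin N) (Fin N) ℝ) (Q : Fin N → Fin N → ℝ)
    (d : Fin N → ℝ) : Prop where
  orthonormal : ∀ i j, ∑ k, Q k i * Q k j = if i = j then 1 else 0
  eigen : ∀ k j, ∑ i, Q k i * W i j = d k * Q k j
  pos : ∀ k, 0 < d k
  sum_eq_zero : ∀ k, d k ≠ 1 → ∑ i, Q k i = 0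
  le_mixingRate : ∀ k, d k ≠ 1 → d k ≤ mixingRate W
  const : ∀ k, d k = 1 → ∀ i j, Q k i = Q k j

theorem norm_sub_average_mulVec_le {N : ℕ} (W : Matrix (Fin N) (Fin N) ℝ)
    (v : EuclideanSpace ℝ (Fin N)) :
    ‖WithLp.toLp 2 ((W - Matrix.of fun _ _ => 1 / (N : ℝ)).mulVec v.ofLp)‖
      ≤ mixingRate W * ‖v‖ := by
  rw [← Matrix.toEuclideanCLM_toLp (n := Fin N) (𝕜 := ℝ)]
  exact ContinuousLinearMap.le_opNorm _ _

theorem IsWeightMatrix.exists_isSpectralBasis {N : ℕ} (hN : 0 < N)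
    {W : Matrix (Fin N) (Fin N) ℝ} (hW : IsWeightMatrix W) (hlam : mixingRate W < 1) :
    ∃ Q d, IsSpectralBasis W Q d := by
  have hH : W.IsHermitian := hW.posDef.isHermitian
  have hNR : (N : ℝ) ≠ 0 := by positivity
  obtain ⟨-, hrow, hcol⟩ := mem_doublyStochastic_iff_sum.1 hW.doublyStochastic
  set b := hH.eigenvectorBasis with hb
  have hmul : ∀ k i, ∑ j, W i j * b k j = hH.eigenvalues k * b k i := by
    intro k i
    have := congrFun (hH.mulVec_eigenvectorBasis k) i
    simpa [Matrix.mulVec, dotProduct] using this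
  have heig : ∀ k j, ∑ i, b k i * W i j = hH.eigenvalues k * b k j := by
    intro k j
    rw [← hmul k j]
    refine Finset.sum_congr rfl fun i _ => ?_
    rw [hW.symm.apply i j, mul_comm]
  have hsum : ∀ k, ∑ i, b k i = hH.eigenvalues k * ∑ i, b k i := by
    intro k
    calc ∑ i, b k i = ∑ i, b k i * ∑ j, W i j := by simp [hrow]
      _ = ∑ j, ∑ i, b k i * W i j := by
        simp_rw [Finset.mul_sum]; exact Finset.sum_comm
      _ = _ := by simp_rw [heig, Finset.mul_sum]
  have hzero : ∀ k, hH.eigenvalues k ≠ 1 → ∑ i, b k i = 0 := by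
    intro k hk
    have h := hsum k
    have : (1 - hH.eigenvalues k) * ∑ i, b k i = 0 := by linarith
    exact (mul_eq_zero.1 this).resolve_left (sub_ne_zero.2 (Ne.symm hk))
  refine ⟨fun k i => b k i, hH.eigenvalues, ?_, heig, hW.posDef.eigenvalues_pos, hzero, ?_, ?_⟩
  · intro i j
    -- Parseval for two standard basis vectors: the sum runs over the eigenvectors, with the node
    -- indices fixed.
    have h := b.sum_inner_mul_inner (EuclideanSpace.single i (1 : ℝ)) (EuclideanSpace.single j 1)
    simp only [EuclideanSpace.inner_single_left, EuclideanSpace.inner_single_right] at h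
    simpa [Pi.single_apply, eq_comm] using h
  · intro k hk
    have h := norm_sub_average_mulVec_le W (b k)
    have he : WithLp.toLp 2 ((W - Matrix.of fun _ _ => 1 / (N : ℝ)).mulVec (b k).ofLp)
        = hH.eigenvalues k • b k := by
      ext i
      have : ∑ j, (W i j - 1 / (N : ℝ)) * b k j = hH.eigenvalues k * b k i := by
        simp_rw [sub_mul, Finset.sum_sub_distrib, ← Finset.mul_sum, hmul, hzero k hk]
        ring
      simpa [Matrix.mulVec, dotProduct] using this
    rw [he, norm_smul, b.norm_eq_one, mul_one, mul_one] at h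
    exact (le_abs_self _).trans h
  · intro k hk
    -- An eigenvector of eigenvalue 1 minus its mean is fixed by `W - (1/N) 𝟙𝟙ᵀ`, whose norm is
    -- below one; hence it vanishes.
    set a : ℝ := (1 / (N : ℝ)) * ∑ i, b k i with ha
    set v : EuclideanSpace ℝ (Fin N) := WithLp.toLp 2 fun i => b k i - a with hv
    have h := norm_sub_average_mulVec_le W v
    have he : WithLp.toLp 2 ((W - Matrix.of fun _ _ => 1 / (N : ℝ)).mulVec v.ofLp) = v := by
      ext i
      have : ∑ j, (W i j - 1 / (N : ℝ)) * (b k j - a) = b k i - a := by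
        simp_rw [sub_mul, mul_sub, Finset.sum_sub_distrib, ← Finset.mul_sum, ← Finset.sum_mul,
          hmul, hrow, hk, ← ha]
        simp
        field_simp
        ring
      simpa [Matrix.mulVec, dotProduct, hv] using this
    rw [he] at h
    have hv0 : v = 0 := by
      rw [← norm_eq_zero]
      nlinarith [norm_nonneg v]
    have hi : ∀ i, b k i = a := fun i => by
      have := congrArg (fun u : EuclideanSpace ℝ (Fin N) => u i) hv0
      simpa [hv, sub_eq_zero] using this
    intro i j
    rw [hi i, hi j]

theorem IsWeightMatrix.minEigenvalue_pos {N : ℕ} (hN : 0 < N)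
    {W : Matrix (Fin N) (Fin N) ℝ} (hW : IsWeightMatrix W) : 0 < minEigenvalue W := by
  have hH : W.IsHermitian := hW.posDef.isHermitian
  have : Nonempty (Fin N) := ⟨⟨0, hN⟩⟩
  have hmem : sInf (spectrum ℝ W) ∈ spectrum ℝ W := by
    rw [hH.spectrum_real_eq_range_eigenvalues]
    exact (Set.range_nonempty _).csInf_mem (Set.finite_range _)
  rw [hH.spectrum_real_eq_range_eigenvalues] at hmem
  obtain ⟨k, hk⟩ := hmem
  rw [minEigenvalue, hH.spectrum_real_eq_range_eigenvalues, ← hk]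
  exact hW.posDef.eigenvalues_pos k

/-- The constant vector is an eigenvector of eigenvalue 1. The convergence bound is obtained without
the smallest eigenvalue; this inequality allows the factor to be inserted at the end. -/
theorem IsWeightMatrix.minEigenvalue_le_one {N : ℕ} (hN : 0 < N)
    {W : Matrix (Fin N) (Fin N) ℝ} (hW : IsWeightMatrix W) : minEigenvalue W ≤ 1 := by
  have hH : W.IsHermitian := hW.posDef.isHermitian
  obtain ⟨-, hrow, -⟩ := mem_doublyStochastic_iff_sum.1 hW.doublyStochastic
  refine csInf_le ?_ ?_
  · rw [hH.spectrum_real_eq_range_eigenvalues]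
    exact (Set.finite_range _).bddBelow
  · rw [← Matrix.spectrum_toLin']
    refine Module.End.HasEigenvalue.mem_spectrum
      (Module.End.hasEigenvalue_of_hasEigenvector (x := fun _ => (1 : ℝ)) ⟨?_, ?_⟩)
    · rw [Module.End.mem_eigenspace_iff]
      ext i
      simp [Matrix.mulVec, dotProduct, hrow]
    · intro h
      simpa using congrFun h ⟨0, hN⟩

/-- The coordinate of a network vector along the direction `q`. -/
noncomputable def mode {N m : ℕ} (q : Fin N → ℝ) (u : Fin N → Vec m) : Vec m :=
  ∑ i, q i • u i

section Mode

variable {N m : ℕ} (q : Fin N → ℝ) (u v : Fin N → Vec m)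

theorem mode_add : mode q (fun i => u i + v i) = mode q u + mode q v := by
  simp [mode, Finset.sum_add_distrib]

theorem mode_sub : mode q (fun i => u i - v i) = mode q u - mode q v := by
  simp only [mode, smul_sub, Finset.sum_sub_distrib]

theorem mode_smul (c : ℝ) : mode q (fun i => c • u i) = c • mode q u := by
  simp only [mode, Finset.smul_sum]
  exact Finset.sum_congr rfl fun i _ => smul_comm _ _ _

theorem mode_sub_const (hq : ∑ i, q i = 0) (c : Vec m) :
    mode q (fun i => u i - c) = mode q u := by
  simp [mode, smul_sub, Finset.sum_sub_distrib, ← Finset.sum_smul, hq]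

theorem inner_mode_mode :
    inner ℝ (mode q u) (mode q v) = ∑ i, ∑ j, q i * q j * inner ℝ (u i) (v j) := by
  rw [mode, mode, sum_inner]
  simp only [inner_sum, real_inner_smul_left, real_inner_smul_right]
  exact Finset.sum_congr rfl fun i _ => Finset.sum_congr rfl fun j _ => by ring

end Mode

theorem sum_sub_avg {N m : ℕ} (hN : 0 < N) (u : Fin N → Vec m) : ∑ i, (u i - avg u) = 0 := by
  have hNR : (N : ℝ) ≠ 0 := by positivity
  rw [Finset.sum_sub_distrib, Finset.sum_const, Finset.card_univ, Fintype.card_fin, avg,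
    ← Nat.cast_smul_eq_nsmul ℝ, smul_smul, mul_one_div_cancel hNR, one_smul, sub_self]

namespace IsSpectralBasis

variable {N m : ℕ} {W : Matrix (Fin N) (Fin N) ℝ} {Q : Fin N → Fin N → ℝ} {d : Fin N → ℝ}

theorem sum_norm_mode_sq (h : IsSpectralBasis W Q d) (u : Fin N → Vec m) :
    ∑ k, ‖mode (Q k) u‖ ^ 2 = ∑ i, ‖u i‖ ^ 2 := by
  simp_rw [← real_inner_self_eq_norm_sq, inner_mode_mode]
  rw [Finset.sum_comm]
  refine Finset.sum_congr rfl fun i _ => ?_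
  rw [Finset.sum_comm]
  simp_rw [← Finset.sum_mul, h.orthonormal]
  simp

theorem mode_mulVec (h : IsSpectralBasis W Q d) (k : Fin N) (u : Fin N → Vec m) :
    mode (Q k) (fun i => ∑ j, W i j • u j) = d k • mode (Q k) u := by
  simp only [mode, Finset.smul_sum, smul_smul]
  rw [Finset.sum_comm]
  simp_rw [← Finset.sum_smul, h.eigen]

/-- The directions orthogonal to consensus. -/
noncomputable def directions (d : Fin N → ℝ) : Finset (Fin N) :=
  Finset.univ.filter fun k => d k ≠ 1

/-- Subtracting the average changes no mode with `d k ≠ 1` and annihilates the others, whose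
directions are constant, so Parseval applies. -/
theorem sum_directions_norm_mode_sq (hN : 0 < N) (h : IsSpectralBasis W Q d)
    (u : Fin N → Vec m) :
    ∑ k ∈ directions d, ‖mode (Q k) u‖ ^ 2 = disagreement u := by
  rw [disagreement, ← h.sum_norm_mode_sq, ← Finset.sum_subset (Finset.subset_univ (directions d))]
  · refine Finset.sum_congr rfl fun k hk => ?_
    rw [mode_sub_const _ _ (h.sum_eq_zero k (by simpa [directions] using hk))]
  · intro k _ hk
    have hk1 : d k = 1 := by simpa [directions] using hk
    have : mode (Q k) (fun i => u i - avg u) = 0 := by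
      rw [mode, Finset.sum_congr rfl fun i _ => by rw [h.const k hk1 i ⟨0, hN⟩],
        ← Finset.smul_sum, sum_sub_avg hN, smul_zero]
    simp [this]

theorem sum_directions_norm_mode_sq_le (h : IsSpectralBasis W Q d) (u : Fin N → Vec m) :
    ∑ k ∈ directions d, ‖mode (Q k) u‖ ^ 2 ≤ ∑ i, ‖u i‖ ^ 2 := by
  rw [← h.sum_norm_mode_sq]
  exact Finset.sum_le_sum_of_subset_of_nonneg (Finset.subset_univ _) fun _ _ _ => by positivity

theorem mem_directions {k : Fin N} : k ∈ directions d ↔ d k ≠ 1 := by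
  simp [directions]

end IsSpectralBasis
/-! ### Norm inequalities -/

theorem norm_sum_sq_le {E ι : Type*} [NormedAddCommGroup E] (s : Finset ι) (v : ι → E) :
    ‖∑ i ∈ s, v i‖ ^ 2 ≤ s.card * ∑ i ∈ s, ‖v i‖ ^ 2 := by
  calc ‖∑ i ∈ s, v i‖ ^ 2 ≤ (∑ i ∈ s, ‖v i‖) ^ 2 := by gcongr; exact norm_sum_le _ _
    _ ≤ _ := sq_sum_le_card_mul_sum_sq

theorem norm_sub_four_sq_le {E : Type*} [NormedAddCommGroup E] (a b c d e : E) :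
    ‖a - b - c - d - e‖ ^ 2
      ≤ 5 * (‖a‖ ^ 2 + ‖b‖ ^ 2 + ‖c‖ ^ 2 + ‖d‖ ^ 2 + ‖e‖ ^ 2) := by
  have h := norm_sum_sq_le Finset.univ ![a, -b, -c, -d, -e]
  simp only [Fin.sum_univ_five, Finset.card_univ, Fintype.card_fin, Matrix.cons_val, norm_neg] at h
  have e1 : a - b - c - d - e = a + -b + -c + -d + -e := by abel
  rw [e1]
  exact_mod_cast h

section Norms

variable {E : Type*} [NormedAddCommGroup E] [InnerProductSpace ℝ E]

theorem norm_add_sq_le_two (a b : E) : ‖a + b‖ ^ 2 ≤ 2 * ‖a‖ ^ 2 + 2 * ‖b‖ ^ 2 := by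
  have h := parallelogram_law_with_norm ℝ a b
  nlinarith [norm_nonneg (a - b)]

/-- Young's inequality is spent only on the pairs `P, u` and `u, n`. The product of `P` and `n`
stays exact because its mean will vanish, so the noise `n` costs a constant factor instead of `1/η`;
`u` may depend on the noise of the same round, hence the crude bound for `u, n`. -/
theorem norm_sub_sub_sq_le {η : ℝ} (hη : 0 < η) (P u n : E) :
    ‖P - u - n‖ ^ 2
      ≤ (1 + η) * ‖P‖ ^ 2 + (2 + 1 / η) * ‖u‖ ^ 2 + 2 * ‖n‖ ^ 2 - 2 * inner ℝ P n := by
  have h1 : ‖P - u - n‖ ^ 2 = ‖P‖ ^ 2 + ‖u‖ ^ 2 + ‖n‖ ^ 2 - 2 * inner ℝ P u - 2 * inner ℝ P n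
      + 2 * inner ℝ u n := by
    rw [norm_sub_sq_real, norm_sub_sq_real, inner_sub_left]
    ring
  have h2 : -(2 * inner ℝ P u) ≤ η * ‖P‖ ^ 2 + 1 / η * ‖u‖ ^ 2 := by
    have hs := norm_add_sq_real (η • P) u
    rw [real_inner_smul_left, norm_smul, Real.norm_of_nonneg hη.le] at hs
    have h0 : 0 ≤ (1 / η) * ‖η • P + u‖ ^ 2 := by positivity
    rw [hs] at h0
    have : 1 / η * ((η * ‖P‖) ^ 2 + 2 * (η * inner ℝ P u) + ‖u‖ ^ 2)
        = η * ‖P‖ ^ 2 + 2 * inner ℝ P u + 1 / η * ‖u‖ ^ 2 := by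
      field_simp
    linarith
  have h3 : 2 * inner ℝ u n ≤ ‖u‖ ^ 2 + ‖n‖ ^ 2 := by
    have := norm_sub_sq_real u n
    nlinarith [sq_nonneg ‖u - n‖]
  linarith

/-- The weight of the dual coordinate in the Lyapunov function, in the mode of eigenvalue `d`. -/
noncomputable def dualWeight (d : ℝ) : ℝ := (1 + d) / (2 * (1 - d))

theorem dualWeight_mul {d : ℝ} (hd : d < 1) : dualWeight d * (1 - d) = (1 + d) / 2 := by
  have : 1 - d ≠ 0 := by linarith
  rw [dualWeight]
  field_simp

theorem half_le_dualWeight {d : ℝ} (h0 : 0 < d) (hd : d < 1) : 1 / 2 ≤ dualWeight d := by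
  rw [dualWeight, div_le_div_iff₀ (by norm_num) (by linarith)]
  linarith

theorem dualWeight_le {d lam : ℝ} (hd : d ≤ lam) (hl : lam < 1) :
    dualWeight d ≤ 1 / (1 - lam) := by
  rw [dualWeight, div_le_div_iff₀ (by linarith) (by linarith)]
  nlinarith

/-- One noiseless step of exact diffusion contracts each mode. -/
theorem mode_contraction {d : ℝ} (h0 : 0 < d) (hd : d < 1) (p q : E) :
    ‖d • (p - q)‖ ^ 2 + dualWeight d * ‖d • q + (1 - d) • p‖ ^ 2
      ≤ (1 - (1 - d) / 2) * (‖p‖ ^ 2 + dualWeight d * ‖q‖ ^ 2) := by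
  have ha := dualWeight_mul hd
  set a := dualWeight d with hadef
  have e1 : ‖d • (p - q)‖ ^ 2 = d ^ 2 * (‖p‖ ^ 2 - 2 * inner ℝ p q + ‖q‖ ^ 2) := by
    rw [norm_smul, mul_pow, norm_sub_sq_real, Real.norm_eq_abs, sq_abs]
  have e2 : ‖d • q + (1 - d) • p‖ ^ 2
      = d ^ 2 * ‖q‖ ^ 2 + 2 * (d * (1 - d)) * inner ℝ p q + (1 - d) ^ 2 * ‖p‖ ^ 2 := by
    rw [norm_add_sq_real, norm_smul, norm_smul, mul_pow, mul_pow, Real.norm_eq_abs,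
      Real.norm_eq_abs, sq_abs, sq_abs, real_inner_smul_left, real_inner_smul_right,
      real_inner_comm]
    ring
  have e3 : 2 * inner ℝ p q ≤ ‖p‖ ^ 2 + ‖q‖ ^ 2 := by
    have := norm_sub_sq_real p q
    nlinarith [sq_nonneg ‖p - q‖]
  -- After `e3` the coefficient of `‖p‖²` is exactly `(1 + d)/2`, which explains the weight. For
  -- `‖q‖²` the slack, multiplied by `1 - d`, is `(1 - d)(1 + d)/4`.
  have e4 : d ^ 2 * (1 + a) + d * (1 - d) / 2 ≤ (1 - (1 - d) / 2) * a := by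
    have : (1 - d) * ((1 - (1 - d) / 2) * a - (d ^ 2 * (1 + a) + d * (1 - d) / 2))
        = (1 - d) * (1 + d) / 4 := by
      linear_combination ((1 - (1 - d) / 2) - d ^ 2) * ha
    nlinarith
  have e5 : ‖d • (p - q)‖ ^ 2 + a * ‖d • q + (1 - d) • p‖ ^ 2
      = (1 + d ^ 2) / 2 * ‖p‖ ^ 2 + d ^ 2 * (1 + a) * ‖q‖ ^ 2 + d * (1 - d) * inner ℝ p q := by
    rw [e1, e2]
    linear_combination (2 * d * inner ℝ p q + (1 - d) * ‖p‖ ^ 2) * ha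
  rw [e5]
  have e6 := mul_le_mul_of_nonneg_left e3 (show 0 ≤ d * (1 - d) / 2 by nlinarith)
  have e7 := mul_le_mul_of_nonneg_right e4 (sq_nonneg ‖q‖)
  nlinarith

/-- One step of exact diffusion in the mode of eigenvalue `d`, perturbed by a deterministic error
`e`, a noise `n` and a shift `w` of the dual target. -/
theorem mode_step {d lam : ℝ} (h0 : 0 < d) (hd : d ≤ lam) (hl : lam < 1) (p q e n w : E) :
    ‖d • (p - q - e - n)‖ ^ 2
        + dualWeight d * ‖d • q + (1 - d) • p - (1 - d) • (e + n) + w‖ ^ 2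
      ≤ (1 - (1 - lam) / 4) * (‖p‖ ^ 2 + dualWeight d * ‖q‖ ^ 2)
        + 6 / (1 - lam) * ‖e‖ ^ 2 + 12 / (1 - lam) ^ 2 * ‖w‖ ^ 2 + 2 * ‖n‖ ^ 2
        - ((1 + d ^ 2) * inner ℝ p n + d * (1 - d) * inner ℝ q n) := by
  have hd1 : d < 1 := hd.trans_lt hl
  have hd2 : d ^ 2 ≤ 1 := pow_le_one₀ h0.le hd1.le
  have ha := dualWeight_mul hd1
  have ha0 := half_le_dualWeight h0 hd1
  have hal := dualWeight_le hd hl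
  have hcon := mode_contraction h0 hd1 p q
  set a := dualWeight d with hadef
  set δ := 1 - lam with hδ
  have hδ0 : 0 < δ := by linarith
  have hδ1 : δ < 1 := by linarith
  set P := d • (p - q) with hP
  set R := d • q + (1 - d) • p with hR
  -- The choice `η = δ/4` spends half of the contraction margin: `(1 + δ/4)(1 - δ/2) ≤ 1 - δ/4`.
  have k1 := norm_sub_sub_sq_le (show 0 < δ / 4 by linarith) P (d • e) (d • n)
  have k2 := norm_sub_sub_sq_le (show 0 < δ / 4 by linarith) R ((1 - d) • e - w) ((1 - d) • n)
  have r1 : d • (p - q - e - n) = P - d • e - d • n := by rw [hP]; module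
  have r2 : R - (1 - d) • (e + n) + w = R - ((1 - d) • e - w) - (1 - d) • n := by module
  rw [r1, r2]
  have n1 : ∀ (c : ℝ) (u : E), ‖c • u‖ ^ 2 = c ^ 2 * ‖u‖ ^ 2 := fun c u => by
    rw [norm_smul, mul_pow, Real.norm_eq_abs, sq_abs]
  have k3 : ‖(1 - d) • e - w‖ ^ 2 ≤ 2 * ((1 - d) ^ 2 * ‖e‖ ^ 2) + 2 * ‖w‖ ^ 2 := by
    have := norm_add_sq_le_two ((1 - d) • e) (-w)
    rwa [norm_neg, n1, ← sub_eq_add_neg] at this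
  have i1 : inner ℝ P (d • n) = d ^ 2 * (inner ℝ p n - inner ℝ q n) := by
    rw [hP, real_inner_smul_left, real_inner_smul_right, inner_sub_left]; ring
  have i2 : inner ℝ R ((1 - d) • n) = (1 - d) * (d * inner ℝ q n + (1 - d) * inner ℝ p n) := by
    rw [hR, real_inner_smul_right, inner_add_left, real_inner_smul_left, real_inner_smul_left]
  rw [n1 d e, n1 d n, i1] at k1
  rw [n1 (1 - d) n, i2] at k2
  have k4 := mul_le_mul_of_nonneg_left k2 (show 0 ≤ a by linarith)
  have hη : 2 + 1 / (δ / 4) ≤ 6 / δ := by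
    rw [one_div_div, ← sub_nonneg]
    have : 6 / δ - (2 + 4 / δ) = 2 * (1 - δ) / δ := by field_simp; ring
    rw [this]
    exact div_nonneg (by linarith) hδ0.le
  -- The weight times `(1 - d)²` is `(1 - d²)/2`, so `e` pays no power of `1/δ` here. Only `w`,
  -- which carries no factor `1 - d`, meets the full weight, at most `1/δ`.
  have k5 : d ^ 2 * ‖e‖ ^ 2 + a * ‖(1 - d) • e - w‖ ^ 2 ≤ ‖e‖ ^ 2 + 2 / δ * ‖w‖ ^ 2 := by
    have := mul_le_mul_of_nonneg_left k3 (show 0 ≤ a by linarith)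
    have h2 : a * (2 * ((1 - d) ^ 2 * ‖e‖ ^ 2)) = (1 - d) * (1 + d) * ‖e‖ ^ 2 := by
      linear_combination (2 * (1 - d) * ‖e‖ ^ 2) * ha
    have h3 : a * (2 * ‖w‖ ^ 2) ≤ 2 / δ * ‖w‖ ^ 2 := by
      have := mul_le_mul_of_nonneg_right hal (show 0 ≤ 2 * ‖w‖ ^ 2 by positivity)
      calc _ ≤ 1 / δ * (2 * ‖w‖ ^ 2) := this
        _ = _ := by ring
    linarith
  have hnn : 0 ≤ d ^ 2 * ‖e‖ ^ 2 + a * ‖(1 - d) • e - w‖ ^ 2 := by positivity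
  have k6 := mul_le_mul hη k5 hnn (by positivity)
  have k7 : 6 / δ * (‖e‖ ^ 2 + 2 / δ * ‖w‖ ^ 2) = 6 / δ * ‖e‖ ^ 2 + 12 / δ ^ 2 * ‖w‖ ^ 2 := by
    field_simp
    ring
  rw [k7] at k6
  have hV : 0 ≤ ‖p‖ ^ 2 + a * ‖q‖ ^ 2 := by positivity
  have k8 : (1 + δ / 4) * (‖P‖ ^ 2 + a * ‖R‖ ^ 2) ≤ (1 - δ / 4) * (‖p‖ ^ 2 + a * ‖q‖ ^ 2) := by
    calc _ ≤ (1 + δ / 4) * ((1 - δ / 2) * (‖p‖ ^ 2 + a * ‖q‖ ^ 2)) := by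
          refine mul_le_mul_of_nonneg_left (hcon.trans ?_) (by linarith)
          exact mul_le_mul_of_nonneg_right (by linarith) hV
      _ ≤ _ := by
          rw [← mul_assoc]
          exact mul_le_mul_of_nonneg_right (by nlinarith) hV
  have k9 : 2 * (d ^ 2 * ‖n‖ ^ 2) + a * (2 * ((1 - d) ^ 2 * ‖n‖ ^ 2)) ≤ 2 * ‖n‖ ^ 2 := by
    have h2 : a * (2 * ((1 - d) ^ 2 * ‖n‖ ^ 2)) = (1 - d) * (1 + d) * ‖n‖ ^ 2 := by
      linear_combination (2 * (1 - d) * ‖n‖ ^ 2) * ha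
    rw [h2]
    linarith [mul_nonneg (sub_nonneg.2 hd2) (sq_nonneg ‖n‖)]
  have k10 : a * (2 * ((1 - d) * (d * inner ℝ q n + (1 - d) * inner ℝ p n)))
      = (1 + d) * (d * inner ℝ q n + (1 - d) * inner ℝ p n) := by
    linear_combination (2 * (d * inner ℝ q n + (1 - d) * inner ℝ p n)) * ha
  linarith

end Norms

/-- A function with `L`-Lipschitz gradient lies below its quadratic upper model. -/
theorem le_quadratic_of_lipschitz_gradient {E : Type*} [NormedAddCommGroup E]
    [InnerProductSpace ℝ E] [CompleteSpace E] {f : E → ℝ} {L : ℝ} (hf : Differentiable ℝ f)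
    (hL : ∀ y z, ‖∇ f y - ∇ f z‖ ≤ L * ‖y - z‖) (x v : E) :
    f (x + v) ≤ f x + inner ℝ (∇ f x) v + L / 2 * ‖v‖ ^ 2 := by
  have hderiv : ∀ t : ℝ, HasDerivAt (fun t : ℝ => f (x + t • v)) (inner ℝ (∇ f (x + t • v)) v) t := by
    intro t
    have h1 : HasDerivAt (fun t : ℝ => x + t • v) v t := by
      simpa using ((hasDerivAt_id t).smul_const v).const_add x
    have h2 := (hf (x + t • v)).hasGradientAt.hasFDerivAt.comp_hasDerivAt t h1
    exact h2.congr_deriv (by simp)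
  have hB : ∀ t : ℝ, HasDerivAt (fun t : ℝ => f x + t * inner ℝ (∇ f x) v + L / 2 * ‖v‖ ^ 2 * t ^ 2)
      (inner ℝ (∇ f x) v + L * ‖v‖ ^ 2 * t) t := by
    intro t
    have h1 := ((hasDerivAt_id t).mul_const (inner ℝ (∇ f x) v)).const_add (f x)
    have h2 := ((hasDerivAt_id t).pow 2).const_mul (L / 2 * ‖v‖ ^ 2)
    refine (h1.add h2).congr_deriv ?_
    simp
    ring
  -- Along the segment both sides agree at 0, and the derivative of `f` is dominated by that of the
  -- quadratic model.
  have key := image_le_of_deriv_right_le_deriv_boundary (a := 0) (b := 1)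
    (f := fun t : ℝ => f (x + t • v)) (f' := fun t => inner ℝ (∇ f (x + t • v)) v)
    (fun t _ => (hderiv t).continuousAt.continuousWithinAt)
    (fun t _ => (hderiv t).hasDerivWithinAt)
    (B := fun t : ℝ => f x + t * inner ℝ (∇ f x) v + L / 2 * ‖v‖ ^ 2 * t ^ 2)
    (B' := fun t => inner ℝ (∇ f x) v + L * ‖v‖ ^ 2 * t) (by simp)
    (fun t _ => (hB t).continuousAt.continuousWithinAt)
    (fun t _ => (hB t).hasDerivWithinAt) (by
      intro t ht
      have h1 : inner ℝ (∇ f (x + t • v) - ∇ f x) v ≤ L * ‖x + t • v - x‖ * ‖v‖ :=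
        (real_inner_le_norm _ _).trans (mul_le_mul_of_nonneg_right (hL _ _) (norm_nonneg _))
      rw [add_sub_cancel_left, norm_smul, Real.norm_of_nonneg ht.1, inner_sub_left] at h1
      nlinarith)
    (show (1 : ℝ) ∈ Set.Icc (0 : ℝ) 1 by simp)
  simpa using key

/-! ### Averages over the nodes and the aggregate objective -/

section Avg

variable {N m : ℕ}

theorem avg_add (u v : Fin N → Vec m) : avg (fun i => u i + v i) = avg u + avg v := by
  simp [avg, Finset.sum_add_distrib]

theorem avg_sub (u v : Fin N → Vec m) : avg (fun i => u i - v i) = avg u - avg v := by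
  simp only [avg, Finset.sum_sub_distrib, smul_sub]

theorem avg_smul (c : ℝ) (u : Fin N → Vec m) : avg (fun i => c • u i) = c • avg u := by
  rw [avg, avg, ← Finset.smul_sum, smul_comm]

theorem avg_sum {ι : Type*} (T : Finset ι) (u : ι → Fin N → Vec m) :
    avg (fun i => ∑ t ∈ T, u t i) = ∑ t ∈ T, avg (u t) := by
  simp only [avg]
  rw [Finset.sum_comm, Finset.smul_sum]

theorem norm_avg_sq_le (hN : 0 < N) (u : Fin N → Vec m) :
    ‖avg u‖ ^ 2 ≤ 1 / (N : ℝ) * ∑ i, ‖u i‖ ^ 2 := by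
  have hNR : (0 : ℝ) < N := by exact_mod_cast hN
  have h := norm_sum_sq_le Finset.univ u
  rw [Finset.card_univ, Fintype.card_fin] at h
  rw [avg, norm_smul, mul_pow, Real.norm_of_nonneg (by positivity)]
  calc _ ≤ (1 / (N : ℝ)) ^ 2 * (N * ∑ i, ‖u i‖ ^ 2) := by gcongr
    _ = _ := by field_simp

theorem avg_const (hN : 0 < N) (c : Vec m) : avg (fun _ : Fin N => c) = c := by
  have hNR : (N : ℝ) ≠ 0 := by positivity
  rw [avg, Finset.sum_const, Finset.card_univ, Fintype.card_fin, ← Nat.cast_smul_eq_nsmul ℝ,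
    smul_smul, one_div_mul_cancel hNR, one_smul]

theorem gradient_aggregate {f : Fin N → Vec m → ℝ} (hf : ∀ i, Differentiable ℝ (f i))
    (x : Vec m) : ∇ (aggregate f) x = avg fun i => ∇ (f i) x := by
  have h : HasGradientAt (aggregate f) (avg fun i => ∇ (f i) x) x := by
    rw [hasGradientAt_iff_hasFDerivAt, avg, map_smul, map_sum]
    exact (HasFDerivAt.fun_sum fun i _ => (hf i x).hasGradientAt.hasFDerivAt).const_mul _
  exact h.gradient

theorem differentiable_aggregate {f : Fin N → Vec m → ℝ} (hf : ∀ i, Differentiable ℝ (f i)) :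
    Differentiable ℝ (aggregate f) :=
  (Differentiable.fun_sum fun i _ => hf i).const_mul _

theorem norm_gradient_aggregate_sub_le (hN : 0 < N) {f : Fin N → Vec m → ℝ} {L : ℝ}
    (hf : IsSmoothObjective f L) (y z : Vec m) :
    ‖∇ (aggregate f) y - ∇ (aggregate f) z‖ ≤ L * ‖y - z‖ := by
  have hNR : (0 : ℝ) < N := by exact_mod_cast hN
  rw [gradient_aggregate hf.differentiable, gradient_aggregate hf.differentiable, ← avg_sub, avg,
    norm_smul, Real.norm_of_nonneg (by positivity)]
  calc _ ≤ 1 / (N : ℝ) * ∑ i : Fin N, L * ‖y - z‖ := by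
        gcongr
        exact norm_sum_le_of_le _ fun i _ => hf.lipschitz i y z
    _ = _ := by
        rw [Finset.sum_const, Finset.card_univ, Fintype.card_fin, nsmul_eq_mul]
        field_simp

end Avg

/-! ### One communication round along a sample path -/

section Round

variable {N m : ℕ}

/-- One round of the algorithm with gradients `g i`, gradient errors `s t i` and local iterates
`φ t i`, from the state `(x, y)` to the state `(x', y')`. -/
structure IsRound (W : Matrix (Fin N) (Fin N) ℝ) (g : Fin N → Vec m → Vec m) (τ : ℕ) (α : ℝ)
    (s φ : ℕ → Fin N → Vec m) (x y x' y' : Fin N → Vec m) : Prop where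
  zero : φ 0 = x
  succ : ∀ t i, φ (t + 1) i = φ t i - α • (g i (φ t i) + s t i) - (1 / (τ : ℝ)) • y i
  primal : ∀ i, x' i = ∑ j, W i j • φ τ j
  dual : ∀ i, y' i = y i + φ τ i - x' i
  sum_dual : ∑ i, y i = 0

/-- The deviation of the dual variable from its target `-ατ∇fᵢ(x̄)`. -/
noncomputable def dualError (g : Fin N → Vec m → Vec m) (τ : ℕ) (α : ℝ) (x y : Fin N → Vec m)
    (i : Fin N) : Vec m :=
  y i + (α * τ) • g i (avg x)

/-- The total squared distance of the local iterates from the initial average. -/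
noncomputable def drift (τ : ℕ) (φ : ℕ → Fin N → Vec m) (x : Fin N → Vec m) : ℝ :=
  ∑ t ∈ Finset.range τ, ∑ i, ‖φ t i - avg x‖ ^ 2

/-- The squared size of the errors accumulated by the nodes in the first `t` local steps. -/
noncomputable def accNoise (s : ℕ → Fin N → Vec m) (t : ℕ) : ℝ :=
  ∑ i, ‖∑ l ∈ Finset.range t, s l i‖ ^ 2

/-- The stationarity measure of one round. -/
noncomputable def stationarity (g : Fin N → Vec m → Vec m) (τ : ℕ) (φ : ℕ → Fin N → Vec m)
    (x : Fin N → Vec m) : ℝ :=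
  ‖avg fun i => g i (avg x)‖ ^ 2
    + 1 / (τ : ℝ) * ∑ t ∈ Finset.range τ, ‖avg fun i => g i (φ t i)‖ ^ 2

/-- The Lyapunov function of the consensus error. -/
noncomputable def lyapunov (Q : Fin N → Fin N → ℝ) (d : Fin N → ℝ) (g : Fin N → Vec m → Vec m)
    (τ : ℕ) (α : ℝ) (x y : Fin N → Vec m) : ℝ :=
  ∑ k ∈ IsSpectralBasis.directions d,
    (‖mode (Q k) x‖ ^ 2 + dualWeight (d k) * ‖mode (Q k) (dualError g τ α x y)‖ ^ 2)

/-- The part of the Lyapunov recursion that is linear in the accumulated errors `n`. -/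
noncomputable def lyapunovNoise (Q : Fin N → Fin N → ℝ) (d : Fin N → ℝ)
    (g : Fin N → Vec m → Vec m) (τ : ℕ) (α : ℝ) (x y n : Fin N → Vec m) : ℝ :=
  ∑ k ∈ IsSpectralBasis.directions d,
    ((1 + d k ^ 2) * inner ℝ (mode (Q k) x) (mode (Q k) n)
      + d k * (1 - d k) * inner ℝ (mode (Q k) (dualError g τ α x y)) (mode (Q k) n))

variable {W : Matrix (Fin N) (Fin N) ℝ} {Q : Fin N → Fin N → ℝ} {d : Fin N → ℝ}
  {g : Fin N → Vec m → Vec m} {τ : ℕ} {α L : ℝ} {s φ : ℕ → Fin N → Vec m}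
  {x y x' y' : Fin N → Vec m}

theorem avg_dualError (hy : ∑ i, y i = 0) :
    avg (dualError g τ α x y) = (α * τ) • avg fun i => g i (avg x) := by
  have : avg y = 0 := by rw [avg, hy, smul_zero]
  rw [show dualError g τ α x y = fun i => y i + (α * τ) • g i (avg x) from rfl, avg_add, avg_smul,
    this, zero_add]

theorem disagreement_add_le_lyapunov (hN : 0 < N) (hQ : IsSpectralBasis W Q d)
    (hlam : mixingRate W < 1) :
    disagreement x + disagreement (dualError g τ α x y) ≤ 2 * lyapunov Q d g τ α x y := by
  rw [← hQ.sum_directions_norm_mode_sq hN, ← hQ.sum_directions_norm_mode_sq hN, lyapunov,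
    ← Finset.sum_add_distrib, Finset.mul_sum]
  refine Finset.sum_le_sum fun k hk => ?_
  have hk1 := IsSpectralBasis.mem_directions.1 hk
  have h := half_le_dualWeight (hQ.pos k) ((hQ.le_mixingRate k hk1).trans_lt hlam)
  nlinarith [sq_nonneg ‖mode (Q k) x‖, sq_nonneg ‖mode (Q k) (dualError g τ α x y)‖]

theorem lyapunov_nonneg (hQ : IsSpectralBasis W Q d) (hlam : mixingRate W < 1) :
    0 ≤ lyapunov Q d g τ α x y := by
  refine Finset.sum_nonneg fun k hk => ?_
  have hk1 := IsSpectralBasis.mem_directions.1 hk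
  have h := half_le_dualWeight (hQ.pos k) ((hQ.le_mixingRate k hk1).trans_lt hlam)
  have : 0 ≤ dualWeight (d k) := by linarith
  positivity

theorem stationarity_nonneg : 0 ≤ stationarity g τ φ x := by
  rw [stationarity]
  positivity

namespace IsRound

theorem phi_eq (h : IsRound W g τ α s φ x y x' y') (t : ℕ) (i : Fin N) :
    φ t i = x i - α • ∑ l ∈ Finset.range t, (g i (φ l i) + s l i) - (t / (τ : ℝ)) • y i := by
  induction t with
  | zero => simp [h.zero]
  | succ t ih =>
    rw [h.succ, Finset.sum_range_succ, Nat.cast_succ]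
    nth_rw 1 [ih]
    module

/-- Since `β = 1/τ`, the dual target contributes `αt ∇fᵢ(x̄)` after `t` local steps, exactly
cancelling the gradients of node `i` frozen at `x̄`. Only their average survives, so no
heterogeneity term appears besides the dual error. -/
theorem phi_sub_avg (hτ : 0 < τ) (h : IsRound W g τ α s φ x y x' y') (t : ℕ) (i : Fin N) :
    φ t i - avg x = (x i - avg x)
      - (t / (τ : ℝ)) • (dualError g τ α x y i - avg (dualError g τ α x y))
      - (α * t) • avg (fun i => g i (avg x))
      - α • ∑ l ∈ Finset.range t, (g i (φ l i) - g i (avg x))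
      - α • ∑ l ∈ Finset.range t, s l i := by
  have hτR : (τ : ℝ) ≠ 0 := by positivity
  have e : (t / (τ : ℝ)) • (dualError g τ α x y i - avg (dualError g τ α x y))
      = (t / (τ : ℝ)) • y i + (α * t) • g i (avg x) - (α * t) • avg fun i => g i (avg x) := by
    have e1 : (t / (τ : ℝ)) * (α * τ) = α * t := by field_simp
    rw [avg_dualError h.sum_dual, dualError, smul_sub, smul_add, smul_smul, smul_smul, e1]
  rw [h.phi_eq t i, e, Finset.sum_sub_distrib, Finset.sum_add_distrib, Finset.sum_const,
    Finset.card_range, ← Nat.cast_smul_eq_nsmul ℝ]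
  module

theorem sum_norm_phi_sub_avg_sq_le (hτ : 0 < τ)
    (hg : ∀ i y z, ‖g i y - g i z‖ ≤ L * ‖y - z‖) (h : IsRound W g τ α s φ x y x' y')
    {t : ℕ} (ht : t ≤ τ) :
    ∑ i, ‖φ t i - avg x‖ ^ 2
      ≤ 5 * (disagreement x + disagreement (dualError g τ α x y)
          + N * (α ^ 2 * τ ^ 2 * ‖avg fun i => g i (avg x)‖ ^ 2)
          + α ^ 2 * τ * L ^ 2 * drift τ φ x + α ^ 2 * accNoise s t) := by
  have hτR : (0 : ℝ) < τ := by exact_mod_cast hτ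
  have htR : (t : ℝ) ≤ τ := by exact_mod_cast ht
  have n1 : ∀ (c : ℝ) (u : Vec m), ‖c • u‖ ^ 2 = c ^ 2 * ‖u‖ ^ 2 := fun c u => by
    rw [norm_smul, mul_pow, Real.norm_eq_abs, sq_abs]
  have hi : ∀ i, ‖φ t i - avg x‖ ^ 2
      ≤ 5 * (‖x i - avg x‖ ^ 2 + ‖dualError g τ α x y i - avg (dualError g τ α x y)‖ ^ 2
          + α ^ 2 * τ ^ 2 * ‖avg fun i => g i (avg x)‖ ^ 2
          + α ^ 2 * τ * L ^ 2 * ∑ l ∈ Finset.range τ, ‖φ l i - avg x‖ ^ 2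
          + α ^ 2 * ‖∑ l ∈ Finset.range t, s l i‖ ^ 2) := by
    intro i
    rw [h.phi_sub_avg hτ t i]
    refine (norm_sub_four_sq_le _ _ _ _ _).trans ?_
    rw [n1, n1, n1, n1]
    have b1 : (t / (τ : ℝ)) ^ 2 ≤ 1 :=
      pow_le_one₀ (by positivity) ((div_le_one hτR).2 htR)
    have b2 : (α * t) ^ 2 ≤ α ^ 2 * τ ^ 2 := by
      rw [mul_pow]; gcongr
    have b3 : ‖∑ l ∈ Finset.range t, (g i (φ l i) - g i (avg x))‖ ^ 2
        ≤ τ * L ^ 2 * ∑ l ∈ Finset.range τ, ‖φ l i - avg x‖ ^ 2 := by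
      refine (norm_sum_sq_le _ _).trans ?_
      rw [Finset.card_range, mul_assoc, Finset.mul_sum (Finset.range τ)]
      refine mul_le_mul htR ?_ (by positivity) (by positivity)
      refine (Finset.sum_le_sum_of_subset_of_nonneg (Finset.range_mono ht)
        fun _ _ _ => by positivity).trans (Finset.sum_le_sum fun l _ => ?_)
      rw [← mul_pow]
      gcongr
      exact hg _ _ _
    have c1 := mul_le_mul_of_nonneg_right b1
      (sq_nonneg ‖dualError g τ α x y i - avg (dualError g τ α x y)‖)
    have c2 := mul_le_mul_of_nonneg_right b2 (sq_nonneg ‖avg fun i => g i (avg x)‖)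
    have c3 := mul_le_mul_of_nonneg_left b3 (sq_nonneg α)
    linarith
  refine (Finset.sum_le_sum fun i _ => hi i).trans (le_of_eq ?_)
  rw [← Finset.mul_sum]
  simp only [Finset.sum_add_distrib, ← Finset.mul_sum, Finset.sum_const, Finset.card_univ,
    Fintype.card_fin, nsmul_eq_mul]
  rw [disagreement, disagreement, drift, accNoise, Finset.sum_comm]
  ring

/-- The drift bounds itself: after summation over the local steps it reappears on the right with
factor `5(ατL)² ≤ 1/2`, and absorbing it doubles the constant 5. -/
theorem drift_le (hτ : 0 < τ) (hA : 10 * (α * τ * L) ^ 2 ≤ 1)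
    (hg : ∀ i y z, ‖g i y - g i z‖ ≤ L * ‖y - z‖) (h : IsRound W g τ α s φ x y x' y') :
    drift τ φ x
      ≤ 10 * τ * (disagreement x + disagreement (dualError g τ α x y)
          + N * (α ^ 2 * τ ^ 2 * ‖avg fun i => g i (avg x)‖ ^ 2))
        + 10 * α ^ 2 * ∑ t ∈ Finset.range τ, accNoise s t := by
  have hsum := Finset.sum_le_sum fun t (ht : t ∈ Finset.range τ) =>
    h.sum_norm_phi_sub_avg_sq_le hτ hg (Finset.mem_range.1 ht).le
  rw [← drift, ← Finset.mul_sum, Finset.sum_add_distrib, Finset.sum_const, Finset.card_range,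
    nsmul_eq_mul, ← Finset.mul_sum] at hsum
  have hT : 0 ≤ drift τ φ x := by rw [drift]; positivity
  nlinarith

theorem avg_next (hW : IsWeightMatrix W) (hτ : 0 < τ) (h : IsRound W g τ α s φ x y x' y') :
    avg x' = avg x - α • ∑ t ∈ Finset.range τ, (avg (fun i => g i (φ t i)) + avg (s t)) := by
  have hτR : (τ : ℝ) ≠ 0 := by positivity
  obtain ⟨-, -, hcol⟩ := mem_doublyStochastic_iff_sum.1 hW.doublyStochastic
  have e1 : avg x' = avg (φ τ) := by
    rw [avg, avg]
    congr 1
    simp_rw [h.primal]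
    rw [Finset.sum_comm]
    simp_rw [← Finset.sum_smul, hcol, one_smul]
  have hy : avg y = 0 := by rw [avg, h.sum_dual, smul_zero]
  rw [e1, show φ τ = fun i => (x i - α • ∑ l ∈ Finset.range τ, (g i (φ l i) + s l i))
    - (τ / (τ : ℝ)) • y i from funext fun i => h.phi_eq τ i, avg_sub, avg_sub, avg_smul, avg_smul,
    hy, smul_zero, sub_zero, avg_sum]
  simp_rw [avg_add]

theorem sum_dual_next (hW : IsWeightMatrix W) (h : IsRound W g τ α s φ x y x' y') :
    ∑ i, y' i = 0 := by
  obtain ⟨-, -, hcol⟩ := mem_doublyStochastic_iff_sum.1 hW.doublyStochastic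
  simp_rw [h.dual, Finset.sum_sub_distrib, Finset.sum_add_distrib, h.sum_dual, h.primal]
  rw [Finset.sum_comm (f := fun i j => W i j • φ τ j)]
  simp_rw [← Finset.sum_smul, hcol, one_smul]
  simp

theorem norm_avg_next_sub_sq_le (hW : IsWeightMatrix W) (hτ : 0 < τ)
    (h : IsRound W g τ α s φ x y x' y') :
    ‖avg x' - avg x‖ ^ 2
      ≤ 2 * α ^ 2 * (τ ^ 2 * (1 / (τ : ℝ) * ∑ t ∈ Finset.range τ, ‖avg fun i => g i (φ t i)‖ ^ 2)
        + ‖∑ t ∈ Finset.range τ, avg (s t)‖ ^ 2) := by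
  have hτR : (τ : ℝ) ≠ 0 := by positivity
  rw [h.avg_next hW hτ, sub_sub_cancel_left, norm_neg, norm_smul, mul_pow, Real.norm_eq_abs,
    sq_abs, Finset.sum_add_distrib]
  have h1 := norm_add_sq_le_two (∑ t ∈ Finset.range τ, avg fun i => g i (φ t i))
    (∑ t ∈ Finset.range τ, avg (s t))
  have h2 := norm_sum_sq_le (Finset.range τ) fun t => avg fun i => g i (φ t i)
  rw [Finset.card_range] at h2
  have h3 : (τ : ℝ) ^ 2 * (1 / (τ : ℝ) * ∑ t ∈ Finset.range τ, ‖avg fun i => g i (φ t i)‖ ^ 2)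
      = τ * ∑ t ∈ Finset.range τ, ‖avg fun i => g i (φ t i)‖ ^ 2 := by field_simp
  rw [h3]
  have := mul_le_mul_of_nonneg_left (h1.trans (add_le_add_left
    (mul_le_mul_of_nonneg_left h2 zero_le_two) _)) (sq_nonneg α)
  linarith

/-- The Lyapunov recursion before the perturbations are estimated. -/
theorem lyapunov_le (hQ : IsSpectralBasis W Q d) (hlam : mixingRate W < 1) (hτ : 0 < τ)
    (h : IsRound W g τ α s φ x y x' y') :
    lyapunov Q d g τ α x' y'
      ≤ (1 - (1 - mixingRate W) / 4) * lyapunov Q d g τ α x y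
        + 6 / (1 - mixingRate W)
          * ∑ i, ‖α • ∑ l ∈ Finset.range τ, (g i (φ l i) - g i (avg x))‖ ^ 2
        + 12 / (1 - mixingRate W) ^ 2
          * ∑ i, ‖(α * τ) • (g i (avg x') - g i (avg x))‖ ^ 2
        + 2 * ∑ i, ‖α • ∑ l ∈ Finset.range τ, s l i‖ ^ 2
        - α * lyapunovNoise Q d g τ α x y fun i => ∑ l ∈ Finset.range τ, s l i := by
  have hτR : (τ : ℝ) ≠ 0 := by positivity
  have hδ : 0 < 1 - mixingRate W := by linarith
  set e : Fin N → Vec m := fun i => α • ∑ l ∈ Finset.range τ, (g i (φ l i) - g i (avg x)) with he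
  set w : Fin N → Vec m := fun i => (α * τ) • (g i (avg x') - g i (avg x)) with hw
  set n : Fin N → Vec m := fun i => α • ∑ l ∈ Finset.range τ, s l i with hn
  set z := dualError g τ α x y with hz
  -- After all `τ` steps the gradient at `x̄` is absorbed entirely into `z`, so a round is one
  -- exact-diffusion step with errors `e` and `n`.
  have hφ : φ τ = fun i => x i - z i - e i - n i := by
    funext i
    rw [h.phi_eq τ i, div_self hτR, hz, dualError, he, hn]
    simp only [Finset.sum_sub_distrib, Finset.sum_add_distrib, Finset.sum_const,
      Finset.card_range, ← Nat.cast_smul_eq_nsmul ℝ]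
    module
  have hx' : ∀ k, mode (Q k) x' = d k • (mode (Q k) x - mode (Q k) z - mode (Q k) e
      - mode (Q k) n) := by
    intro k
    rw [show x' = fun i => ∑ j, W i j • φ τ j from funext h.primal, hQ.mode_mulVec, hφ,
      mode_sub, mode_sub, mode_sub]
  have hz' : ∀ k, mode (Q k) (dualError g τ α x' y') = d k • mode (Q k) z
      + (1 - d k) • mode (Q k) x - (1 - d k) • (mode (Q k) e + mode (Q k) n) + mode (Q k) w := by
    intro k
    have : dualError g τ α x' y' = fun i => z i + φ τ i - x' i + w i := by
      funext i
      rw [dualError, h.dual, hz, dualError, hw]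
      module
    rw [this, mode_add, mode_sub, mode_add, hx', hφ, mode_sub, mode_sub, mode_sub]
    module
  have hk : ∀ k ∈ IsSpectralBasis.directions d,
      ‖mode (Q k) x'‖ ^ 2 + dualWeight (d k) * ‖mode (Q k) (dualError g τ α x' y')‖ ^ 2
      ≤ (1 - (1 - mixingRate W) / 4)
          * (‖mode (Q k) x‖ ^ 2 + dualWeight (d k) * ‖mode (Q k) z‖ ^ 2)
        + 6 / (1 - mixingRate W) * ‖mode (Q k) e‖ ^ 2
        + 12 / (1 - mixingRate W) ^ 2 * ‖mode (Q k) w‖ ^ 2 + 2 * ‖mode (Q k) n‖ ^ 2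
        - ((1 + d k ^ 2) * inner ℝ (mode (Q k) x) (mode (Q k) n)
          + d k * (1 - d k) * inner ℝ (mode (Q k) z) (mode (Q k) n)) := by
    intro k hk
    rw [hx', hz']
    exact mode_step (hQ.pos k) (hQ.le_mixingRate k (IsSpectralBasis.mem_directions.1 hk)) hlam
      _ _ _ _ _
  have hsum := Finset.sum_le_sum hk
  simp only [Finset.sum_add_distrib, Finset.sum_sub_distrib, ← Finset.mul_sum] at hsum
  have be := mul_le_mul_of_nonneg_left (hQ.sum_directions_norm_mode_sq_le e)
    (show 0 ≤ 6 / (1 - mixingRate W) by positivity)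
  have bw := mul_le_mul_of_nonneg_left (hQ.sum_directions_norm_mode_sq_le w)
    (show 0 ≤ 12 / (1 - mixingRate W) ^ 2 by positivity)
  have bn := hQ.sum_directions_norm_mode_sq_le n
  have hlin : α * lyapunovNoise Q d g τ α x y (fun i => ∑ l ∈ Finset.range τ, s l i)
      = ∑ k ∈ IsSpectralBasis.directions d, (1 + d k ^ 2) * inner ℝ (mode (Q k) x) (mode (Q k) n)
        + ∑ k ∈ IsSpectralBasis.directions d,
          d k * (1 - d k) * inner ℝ (mode (Q k) z) (mode (Q k) n) := by
    rw [lyapunovNoise, Finset.mul_sum, ← Finset.sum_add_distrib]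
    refine Finset.sum_congr rfl fun k _ => ?_
    rw [hn, mode_smul, real_inner_smul_right, real_inner_smul_right]
    ring
  rw [hlin]
  simp only [lyapunov, Finset.sum_add_distrib, ← hz] at hsum ⊢
  linarith

/-- The Lyapunov recursion of one round. -/
theorem lyapunov_step (hN : 0 < N) (hW : IsWeightMatrix W) (hQ : IsSpectralBasis W Q d)
    (hlam : mixingRate W < 1) (hτ : 0 < τ) (hα : 0 < α) (hL : 0 < L)
    (hA : α * τ * L ≤ (1 - mixingRate W) / 32)
    (hg : ∀ i y z, ‖g i y - g i z‖ ≤ L * ‖y - z‖) (h : IsRound W g τ α s φ x y x' y') :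
    lyapunov Q d g τ α x' y'
      ≤ (1 - (1 - mixingRate W) / 8) * lyapunov Q d g τ α x y
        + 60 * (α * τ * L / (1 - mixingRate W)) ^ 2 * (N * (α ^ 2 * τ ^ 2)) * stationarity g τ φ x
        + α ^ 2 * (2 * accNoise s τ + 1 / (τ : ℝ) * ∑ t ∈ Finset.range τ, accNoise s t
          + N * ‖∑ t ∈ Finset.range τ, avg (s t)‖ ^ 2)
        - α * lyapunovNoise Q d g τ α x y fun i => ∑ l ∈ Finset.range τ, s l i := by
  have hτR : (0 : ℝ) < τ := by exact_mod_cast hτ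
  have hδ : 0 < 1 - mixingRate W := by linarith
  have hδ1 : 1 - mixingRate W ≤ 1 := by
    have : 0 ≤ mixingRate W := norm_nonneg _
    linarith
  have hstep := h.lyapunov_le hQ hlam hτ
  have hdis := disagreement_add_le_lyapunov (x := x) (y := y) (g := g) (τ := τ) (α := α)
    hN hQ hlam
  have hmove := h.norm_avg_next_sub_sq_le hW hτ
  set δ := 1 - mixingRate W with hδdef
  set V := lyapunov Q d g τ α x y with hV
  have hV0 : 0 ≤ V := lyapunov_nonneg hQ hlam
  set A := α * τ * L with hAdef
  have hA0 : 0 < A := by positivity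
  have hAsq : A ^ 2 ≤ (δ / 32) ^ 2 := by gcongr
  have hA1 : 10 * A ^ 2 ≤ 1 := by
    have : (δ / 32) ^ 2 ≤ (1 / 32) ^ 2 := by gcongr
    linarith
  have hdrift := h.drift_le hτ hA1 hg
  set G := ‖avg fun i => g i (avg x)‖ ^ 2 with hG
  set U := 1 / (τ : ℝ) * ∑ t ∈ Finset.range τ, ‖avg fun i => g i (φ t i)‖ ^ 2 with hU
  set q₁ := ∑ t ∈ Finset.range τ, accNoise s t with hq₁
  set q₃ := ‖∑ t ∈ Finset.range τ, avg (s t)‖ ^ 2 with hq₃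
  have hG0 : 0 ≤ G := sq_nonneg _
  have hU0 : 0 ≤ U := mul_nonneg (by positivity) (Finset.sum_nonneg fun _ _ => sq_nonneg _)
  have hq₁0 : 0 ≤ q₁ := Finset.sum_nonneg fun t _ => Finset.sum_nonneg fun i _ => sq_nonneg _
  have hq₃0 : 0 ≤ q₃ := sq_nonneg _
  have hst : stationarity g τ φ x = G + U := rfl
  clear_value V G U q₁ q₃
  have n1 : ∀ (c : ℝ) (u : Vec m), ‖c • u‖ ^ 2 = c ^ 2 * ‖u‖ ^ 2 := fun c u => by
    rw [norm_smul, mul_pow, Real.norm_eq_abs, sq_abs]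
  have he : ∑ i, ‖α • ∑ l ∈ Finset.range τ, (g i (φ l i) - g i (avg x))‖ ^ 2
      ≤ α ^ 2 * (τ * L ^ 2 * drift τ φ x) := by
    simp_rw [n1]
    rw [← Finset.mul_sum]
    refine mul_le_mul_of_nonneg_left ?_ (sq_nonneg _)
    rw [drift, Finset.sum_comm, Finset.mul_sum]
    refine Finset.sum_le_sum fun i _ => (norm_sum_sq_le _ _).trans ?_
    rw [Finset.card_range, mul_assoc]
    refine mul_le_mul_of_nonneg_left ?_ hτR.le
    rw [Finset.mul_sum]
    refine Finset.sum_le_sum fun l _ => ?_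
    rw [← mul_pow]
    gcongr
    exact hg _ _ _
  have hw : ∑ i, ‖(α * τ) • (g i (avg x') - g i (avg x))‖ ^ 2
      ≤ N * (A ^ 2 * ‖avg x' - avg x‖ ^ 2) := by
    have : ∀ i, ‖(α * τ) • (g i (avg x') - g i (avg x))‖ ^ 2 ≤ A ^ 2 * ‖avg x' - avg x‖ ^ 2 := by
      intro i
      rw [n1, hAdef, mul_pow _ L, mul_assoc, ← mul_pow L]
      gcongr
      exact hg _ _ _
    refine (Finset.sum_le_sum fun i _ => this i).trans (le_of_eq ?_)
    simp
  have hn : ∑ i, ‖α • ∑ l ∈ Finset.range τ, s l i‖ ^ 2 = α ^ 2 * accNoise s τ := by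
    simp_rw [n1, ← Finset.mul_sum]
    rfl
  set B := (A / δ) ^ 2 with hB
  have hAB : A ^ 2 = B * δ ^ 2 := by rw [hB]; field_simp
  have hB0 : 0 ≤ B := by positivity
  have hB1 : B ≤ 1 / 1024 := by
    have : A / δ ≤ 1 / 32 := by rw [div_le_iff₀ hδ]; linarith
    calc B ≤ (1 / 32) ^ 2 := by rw [hB]; gcongr
      _ = _ := by norm_num
  have he' : 6 / δ * ∑ i, ‖α • ∑ l ∈ Finset.range τ, (g i (φ l i) - g i (avg x))‖ ^ 2
      ≤ 60 * B * δ * (2 * V + N * (α ^ 2 * τ ^ 2 * G)) + 60 * B * δ * (α ^ 2 * (1 / τ * q₁)) := by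
    have h1 : drift τ φ x ≤ 10 * τ * (2 * V + N * (α ^ 2 * τ ^ 2 * G)) + 10 * α ^ 2 * q₁ := by
      refine hdrift.trans ?_
      gcongr
    calc _ ≤ 6 / δ * (α ^ 2 * (τ * L ^ 2
          * (10 * τ * (2 * V + N * (α ^ 2 * τ ^ 2 * G)) + 10 * α ^ 2 * q₁))) :=
          mul_le_mul_of_nonneg_left (he.trans (by gcongr)) (by positivity)
      _ = 60 * A ^ 2 / δ * (2 * V + N * (α ^ 2 * τ ^ 2 * G))
          + 60 * A ^ 2 / δ * (α ^ 2 * (1 / τ * q₁)) := by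
          rw [hAdef]; field_simp; ring
      _ = _ := by rw [hAB]; field_simp
  have hw' : 12 / δ ^ 2 * ∑ i, ‖(α * τ) • (g i (avg x') - g i (avg x))‖ ^ 2
      ≤ 24 * B * (N * (α ^ 2 * τ ^ 2) * U) + 24 * B * (α ^ 2 * (N * q₃)) := by
    calc _ ≤ 12 / δ ^ 2 * (N * (A ^ 2 * (2 * α ^ 2 * (τ ^ 2 * U + q₃)))) :=
          mul_le_mul_of_nonneg_left (hw.trans (by gcongr)) (by positivity)
      _ = _ := by rw [hAB]; field_simp; ring
  rw [hn] at hstep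
  rw [hst]
  have hNR : (0 : ℝ) ≤ N := Nat.cast_nonneg N
  have c1 : 60 * B * δ * (2 * V) ≤ δ / 8 * V := by
    have := mul_le_mul_of_nonneg_right hB1 (mul_nonneg hδ.le hV0)
    linarith [mul_nonneg hδ.le hV0]
  have c2 : 60 * B * δ * (N * (α ^ 2 * τ ^ 2 * G)) ≤ 60 * B * (N * (α ^ 2 * τ ^ 2)) * G := by
    have : 60 * B * δ * (N * (α ^ 2 * τ ^ 2 * G))
        = (60 * B * (N * (α ^ 2 * τ ^ 2)) * G) * δ := by ring
    rw [this]
    exact mul_le_of_le_one_right (by positivity) hδ1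
  have c3 : 60 * B * δ * (α ^ 2 * (1 / τ * q₁)) ≤ α ^ 2 * (1 / τ * q₁) := by
    refine mul_le_of_le_one_left (by positivity) ?_
    calc 60 * B * δ ≤ 60 * (1 / 1024) * 1 := by gcongr
      _ ≤ 1 := by norm_num
  have c4 : 24 * B * (N * (α ^ 2 * τ ^ 2) * U) ≤ 60 * B * (N * (α ^ 2 * τ ^ 2)) * U := by
    have : 0 ≤ B * (N * (α ^ 2 * τ ^ 2) * U) := by positivity
    linarith
  have c5 : 24 * B * (α ^ 2 * (N * q₃)) ≤ α ^ 2 * (N * q₃) := by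
    refine mul_le_of_le_one_left (by positivity) ?_
    linarith
  linarith

/-- The descent of the aggregate objective in one round. -/
theorem descent {f : Fin N → Vec m → ℝ} (hN : 0 < N) (hW : IsWeightMatrix W)
    (hQ : IsSpectralBasis W Q d) (hlam : mixingRate W < 1) (hτ : 0 < τ) (hα : 0 < α)
    (hf : IsSmoothObjective f L) (hA : α * τ * L ≤ 1 / 32)
    (h : IsRound W (fun i => ∇ (f i)) τ α s φ x y x' y') :
    aggregate f (avg x')
      ≤ aggregate f (avg x) - α * τ / 4 * stationarity (fun i => ∇ (f i)) τ φ x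
        + 10 * α * τ * L ^ 2 / N * lyapunov Q d (fun i => ∇ (f i)) τ α x y
        + 5 * α ^ 3 * L ^ 2 / N * ∑ t ∈ Finset.range τ, accNoise s t
        + L * α ^ 2 * ‖∑ t ∈ Finset.range τ, avg (s t)‖ ^ 2
        - α * inner ℝ (avg fun i => ∇ (f i) (avg x)) (∑ t ∈ Finset.range τ, avg (s t)) := by
  have hτR : (0 : ℝ) < τ := by exact_mod_cast hτ
  have hNR : (0 : ℝ) < N := by exact_mod_cast hN
  have hL := hf.pos
  have hdis := disagreement_add_le_lyapunov (x := x) (y := y) (g := fun i => ∇ (f i)) (τ := τ)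
    (α := α) hN hQ hlam
  have hmove := h.norm_avg_next_sub_sq_le hW hτ
  have hquad := le_quadratic_of_lipschitz_gradient (differentiable_aggregate hf.differentiable)
    (norm_gradient_aggregate_sub_le hN hf) (avg x) (avg x' - avg x)
  rw [add_sub_cancel, gradient_aggregate hf.differentiable] at hquad
  set A := α * τ * L with hAdef
  have hA0 : 0 < A := by positivity
  have hAsq : A ^ 2 ≤ (1 / 32) ^ 2 := by gcongr
  have hdrift := h.drift_le hτ (by linarith) hf.lipschitz
  have hinner : inner ℝ (avg fun i => ∇ (f i) (avg x)) (avg x' - avg x)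
      = -(α * ∑ t ∈ Finset.range τ,
          inner ℝ (avg fun i => ∇ (f i) (avg x)) (avg fun i => ∇ (f i) (φ t i)))
        - α * inner ℝ (avg fun i => ∇ (f i) (avg x)) (∑ t ∈ Finset.range τ, avg (s t)) := by
    rw [h.avg_next hW hτ, sub_sub_cancel_left, inner_neg_right, real_inner_smul_right,
      Finset.sum_add_distrib, inner_add_right, inner_sum]
    ring
  -- Polarization, `2⟨a, b⟩ = ‖a‖² + ‖b‖² - ‖a - b‖²`, produces both halves of the stationarity
  -- measure; the Lipschitz bound charges the difference to the drift.
  have hcorr : ∀ t ∈ Finset.range τ,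
      1 / 2 * ‖avg fun i => ∇ (f i) (avg x)‖ ^ 2 + 1 / 2 * ‖avg fun i => ∇ (f i) (φ t i)‖ ^ 2
        - L ^ 2 / (2 * N) * ∑ i, ‖φ t i - avg x‖ ^ 2
      ≤ inner ℝ (avg fun i => ∇ (f i) (avg x)) (avg fun i => ∇ (f i) (φ t i)) := by
    intro t _
    have h1 := norm_sub_sq_real (avg fun i => ∇ (f i) (φ t i)) (avg fun i => ∇ (f i) (avg x))
    rw [real_inner_comm] at h1
    have h2 : ‖(avg fun i => ∇ (f i) (φ t i)) - avg fun i => ∇ (f i) (avg x)‖ ^ 2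
        ≤ 1 / (N : ℝ) * (L ^ 2 * ∑ i, ‖φ t i - avg x‖ ^ 2) := by
      rw [← avg_sub]
      refine (norm_avg_sq_le hN _).trans (mul_le_mul_of_nonneg_left ?_ (by positivity))
      rw [Finset.mul_sum]
      refine Finset.sum_le_sum fun i _ => ?_
      rw [← mul_pow]
      gcongr
      exact hf.lipschitz _ _ _
    have h3 : 1 / (N : ℝ) * (L ^ 2 * ∑ i, ‖φ t i - avg x‖ ^ 2)
        = 2 * (L ^ 2 / (2 * N) * ∑ i, ‖φ t i - avg x‖ ^ 2) := by field_simp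
    linarith
  have hsum := Finset.sum_le_sum hcorr
  rw [Finset.sum_sub_distrib, Finset.sum_add_distrib, Finset.sum_const, Finset.card_range,
    nsmul_eq_mul, ← Finset.mul_sum, ← Finset.mul_sum, ← drift] at hsum
  have hsum' := mul_le_mul_of_nonneg_left hsum hα.le
  set V := lyapunov Q d (fun i => ∇ (f i)) τ α x y with hV
  set G := ‖avg fun i => ∇ (f i) (avg x)‖ ^ 2 with hG
  set S := ∑ t ∈ Finset.range τ, ‖avg fun i => ∇ (f i) (φ t i)‖ ^ 2 with hS
  set q₁ := ∑ t ∈ Finset.range τ, accNoise s t with hq₁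
  set q₃ := ‖∑ t ∈ Finset.range τ, avg (s t)‖ ^ 2 with hq₃
  have hG0 : 0 ≤ G := sq_nonneg _
  have hS0 : 0 ≤ S := Finset.sum_nonneg fun _ _ => sq_nonneg _
  have hst : stationarity (fun i => ∇ (f i)) τ φ x = G + 1 / (τ : ℝ) * S := rfl
  clear_value V G S q₁ q₃
  have hT : α * (L ^ 2 / (2 * N) * drift τ φ x)
      ≤ 10 * α * τ * L ^ 2 / N * V + α * τ * (5 * A ^ 2) * G + 5 * α ^ 3 * L ^ 2 / N * q₁ := by
    calc _ ≤ α * (L ^ 2 / (2 * N) * (10 * τ * (2 * V + N * (α ^ 2 * τ ^ 2 * G))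
          + 10 * α ^ 2 * q₁)) := by
          gcongr
          refine hdrift.trans ?_
          gcongr
      _ = _ := by rw [hAdef]; field_simp; ring
  have hM : L / 2 * ‖avg x' - avg x‖ ^ 2 ≤ α * A * S + L * α ^ 2 * q₃ := by
    calc _ ≤ L / 2 * (2 * α ^ 2 * (τ ^ 2 * (1 / (τ : ℝ) * S) + q₃)) := by gcongr
      _ = _ := by rw [hAdef]; field_simp
  -- The drift and the quadratic term each consume at most half of the coefficient 1/2 supplied by
  -- polarization, leaving 1/4.
  have c1 : α * τ * (5 * A ^ 2) * G ≤ α * τ * (1 / 4) * G := by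
    gcongr
    linarith
  have c2 : α * A * S ≤ α * (1 / 4) * S := by
    gcongr
    linarith
  have c3 : α * τ / 4 * (G + 1 / (τ : ℝ) * S) = α * τ / 4 * G + α / 4 * S := by field_simp
  rw [hst, c3]
  linarith

end IsRound
end Round
-- Summation over the rounds along a sample path
section Trajectory

variable {N m : ℕ} {W : Matrix (Fin N) (Fin N) ℝ} {Q : Fin N → Fin N → ℝ} {d : Fin N → ℝ}

/-- The effect of the gradient errors on the Lyapunov recursion. -/
noncomputable def consensusNoise (Q : Fin N → Fin N → ℝ) (d : Fin N → ℝ)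
    (g : Fin N → Vec m → Vec m) (τ : ℕ) (α : ℝ) (s : ℕ → Fin N → Vec m) (x y : Fin N → Vec m) :
    ℝ :=
  α ^ 2 * (2 * accNoise s τ + 1 / (τ : ℝ) * ∑ t ∈ Finset.range τ, accNoise s t
      + N * ‖∑ t ∈ Finset.range τ, avg (s t)‖ ^ 2)
    - α * lyapunovNoise Q d g τ α x y fun i => ∑ l ∈ Finset.range τ, s l i

/-- The effect of the gradient errors on the objective. -/
noncomputable def descentNoise (g : Fin N → Vec m → Vec m) (L : ℝ) (τ : ℕ) (α : ℝ)
    (s : ℕ → Fin N → Vec m) (x : Fin N → Vec m) : ℝ :=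
  5 * α ^ 3 * L ^ 2 / N * ∑ t ∈ Finset.range τ, accNoise s t
    + L * α ^ 2 * ‖∑ t ∈ Finset.range τ, avg (s t)‖ ^ 2
    - α * inner ℝ (avg fun i => g i (avg x)) (∑ t ∈ Finset.range τ, avg (s t))

/-- Both recursions telescope. Bounding the summed Lyapunov values in the descent by the consensus
recursion returns stationarity with coefficient at most `ατ/8`, half of the `ατ/4` gained. -/
theorem sum_stationarity_le {f : Fin N → Vec m → ℝ} {L α : ℝ} {τ : ℕ} (hN : 0 < N)
    (hW : IsWeightMatrix W) (hQ : IsSpectralBasis W Q d) (hlam : mixingRate W < 1) (hτ : 0 < τ)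
    (hα : 0 < α) (hf : IsSmoothObjective f L) (hA : α * τ * L ≤ (1 - mixingRate W) / 32)
    {s φ : ℕ → ℕ → Fin N → Vec m} {x y : ℕ → Fin N → Vec m}
    (h : ∀ r, IsRound W (fun i => ∇ (f i)) τ α (s r) (φ r) (x r) (y r) (x (r + 1)) (y (r + 1)))
    (R : ℕ) :
    α * τ / 8 * ∑ r ∈ Finset.range R, stationarity (fun i => ∇ (f i)) τ (φ r) (x r)
      ≤ aggregate f (avg (x 0)) - (⨅ z, aggregate f z)
        + 80 * α * τ * L ^ 2 / (N * (1 - mixingRate W))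
          * (lyapunov Q d (fun i => ∇ (f i)) τ α (x 0) (y 0)
            + ∑ r ∈ Finset.range R, consensusNoise Q d (fun i => ∇ (f i)) τ α (s r) (x r) (y r))
        + ∑ r ∈ Finset.range R, descentNoise (fun i => ∇ (f i)) L τ α (s r) (x r) := by
  have hτR : (0 : ℝ) < τ := by exact_mod_cast hτ
  have hNR : (0 : ℝ) < N := by exact_mod_cast hN
  have hL := hf.pos
  have hδ : 0 < 1 - mixingRate W := by linarith
  have hδ1 : 1 - mixingRate W ≤ 1 := by
    have : 0 ≤ mixingRate W := norm_nonneg _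
    linarith
  have hmin : (⨅ z, aggregate f z) ≤ aggregate f (avg (x R)) := ciInf_le hf.bddBelow _
  set g : Fin N → Vec m → Vec m := fun i => ∇ (f i) with hg
  have hVsum : ∀ R, lyapunov Q d g τ α (x R) (y R)
      + (1 - mixingRate W) / 8 * ∑ r ∈ Finset.range R, lyapunov Q d g τ α (x r) (y r)
      ≤ lyapunov Q d g τ α (x 0) (y 0)
        + 60 * (α * τ * L / (1 - mixingRate W)) ^ 2 * (N * (α ^ 2 * τ ^ 2))
          * ∑ r ∈ Finset.range R, stationarity g τ (φ r) (x r)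
        + ∑ r ∈ Finset.range R, consensusNoise Q d g τ α (s r) (x r) (y r) := by
    intro R
    induction R with
    | zero => simp
    | succ R ih =>
      have hstep := (h R).lyapunov_step hN hW hQ hlam hτ hα hL hA hf.lipschitz
      rw [Finset.sum_range_succ, Finset.sum_range_succ, Finset.sum_range_succ]
      rw [consensusNoise]
      linarith
  have hFsum : ∀ R, aggregate f (avg (x R))
      + α * τ / 4 * ∑ r ∈ Finset.range R, stationarity g τ (φ r) (x r)
      ≤ aggregate f (avg (x 0))
        + 10 * α * τ * L ^ 2 / N * ∑ r ∈ Finset.range R, lyapunov Q d g τ α (x r) (y r)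
        + ∑ r ∈ Finset.range R, descentNoise g L τ α (s r) (x r) := by
    intro R
    induction R with
    | zero => simp
    | succ R ih =>
      have hstep := (h R).descent hN hW hQ hlam hτ hα hf (by linarith)
      rw [Finset.sum_range_succ, Finset.sum_range_succ, Finset.sum_range_succ]
      rw [descentNoise]
      linarith
  have hV := hVsum R
  have hF := hFsum R
  have hVR : 0 ≤ lyapunov Q d g τ α (x R) (y R) := lyapunov_nonneg hQ hlam
  have hS : 0 ≤ ∑ r ∈ Finset.range R, stationarity g τ (φ r) (x r) :=
    Finset.sum_nonneg fun _ _ => stationarity_nonneg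
  set S := ∑ r ∈ Finset.range R, stationarity g τ (φ r) (x r)
  set SV := ∑ r ∈ Finset.range R, lyapunov Q d g τ α (x r) (y r)
  set SC := ∑ r ∈ Finset.range R, consensusNoise Q d g τ α (s r) (x r) (y r)
  set SD := ∑ r ∈ Finset.range R, descentNoise g L τ α (s r) (x r)
  set V₀ := lyapunov Q d g τ α (x 0) (y 0)
  clear_value S SV SC SD V₀
  set δ := 1 - mixingRate W with hδdef
  clear_value δ
  set B := α * τ * L / δ with hB
  have hB0 : 0 ≤ B := by positivity
  have hB1 : B ≤ 1 / 32 := by rw [hB, div_le_iff₀ hδ]; linarith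
  have hV' : δ / 8 * SV ≤ V₀ + SC + 60 * B ^ 2 * (N * (α ^ 2 * τ ^ 2)) * S := by linarith
  -- The multiplier turns `δ/8` into the coefficient `10ατL²/N` of the Lyapunov sum in `hF`.
  have hκ := mul_le_mul_of_nonneg_left hV' (show 0 ≤ 80 * α * τ * L ^ 2 / (N * δ) by positivity)
  have e1 : 80 * α * τ * L ^ 2 / (N * δ) * (δ / 8 * SV) = 10 * α * τ * L ^ 2 / N * SV := by
    field_simp
    ring
  have e2 : 80 * α * τ * L ^ 2 / (N * δ) * (60 * B ^ 2 * (N * (α ^ 2 * τ ^ 2)) * S)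
      = α * τ * (4800 * B ^ 4 * δ) * S := by
    rw [hB]
    field_simp
    ring
  have e3 : α * τ * (4800 * B ^ 4 * δ) * S ≤ α * τ * (1 / 8) * S := by
    gcongr
    calc 4800 * B ^ 4 * δ ≤ 4800 * (1 / 32) ^ 4 * 1 := by gcongr
      _ ≤ _ := by norm_num
  rw [e1, mul_add, e2] at hκ
  linarith

/-- The initial value of the Lyapunov function. -/
theorem lyapunov_initial_le {f : Fin N → Vec m → ℝ} {α : ℝ} {τ : ℕ} {x₀ y₀ : Fin N → Vec m}
    (hN : 0 < N) (hQ : IsSpectralBasis W Q d) (hlam : mixingRate W < 1)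
    (hf : ∀ i, Differentiable ℝ (f i))
    (hy : (∀ i, y₀ i = x₀ i - ∑ j, W i j • x₀ j) ∨ (∀ i, y₀ i = 0)) :
    lyapunov Q d (fun i => ∇ (f i)) τ α x₀ y₀
      ≤ 2 * disagreement x₀
        + 2 / (1 - mixingRate W) * (α ^ 2 * τ ^ 2 * (N * heterogeneity f (avg x₀))) := by
  have hNR : (0 : ℝ) < N := by exact_mod_cast hN
  have hδ : 0 < 1 - mixingRate W := by linarith
  have hhet : N * heterogeneity f (avg x₀) = disagreement fun i => ∇ (f i) (avg x₀) := by
    rw [heterogeneity, disagreement, gradient_aggregate hf]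
    field_simp
  rw [hhet, ← hQ.sum_directions_norm_mode_sq hN, ← hQ.sum_directions_norm_mode_sq hN, lyapunov]
  simp only [Finset.mul_sum]
  rw [← Finset.sum_add_distrib]
  refine Finset.sum_le_sum fun k hk => ?_
  have hk1 := IsSpectralBasis.mem_directions.1 hk
  have hdl := hQ.le_mixingRate k hk1
  have hd0 := hQ.pos k
  have hd1 : d k < 1 := hdl.trans_lt hlam
  have ha := dualWeight_mul hd1
  have ha0 := half_le_dualWeight hd0 hd1
  have hal := dualWeight_le hdl hlam
  have hz : mode (Q k) (dualError (fun i => ∇ (f i)) τ α x₀ y₀)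
      = mode (Q k) y₀ + (α * τ) • mode (Q k) (fun i => ∇ (f i) (avg x₀)) := by
    rw [show dualError (fun i => ∇ (f i)) τ α x₀ y₀
      = fun i => y₀ i + (α * τ) • ∇ (f i) (avg x₀) from rfl, mode_add, mode_smul]
  -- For `y₀ = (I - W)x₀` the mode carries a factor `1 - d`, which compensates the weight: `2(1 -
  -- d)²` times it is `1 - d² ≤ 1`.
  have hy' : dualWeight (d k) * (2 * ‖mode (Q k) y₀‖ ^ 2) ≤ ‖mode (Q k) x₀‖ ^ 2 := by
    rcases hy with hy | hy
    · have : mode (Q k) y₀ = (1 - d k) • mode (Q k) x₀ := by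
        rw [show y₀ = fun i => x₀ i - ∑ j, W i j • x₀ j from funext hy, mode_sub,
          hQ.mode_mulVec]
        module
      rw [this, norm_smul, mul_pow, Real.norm_eq_abs, sq_abs]
      have e : dualWeight (d k) * (2 * ((1 - d k) ^ 2 * ‖mode (Q k) x₀‖ ^ 2))
          = (1 - d k ^ 2) * ‖mode (Q k) x₀‖ ^ 2 := by
        linear_combination (2 * (1 - d k) * ‖mode (Q k) x₀‖ ^ 2) * ha
      rw [e]
      exact mul_le_of_le_one_left (sq_nonneg _) (by linarith [sq_nonneg (d k)])
    · have : mode (Q k) y₀ = 0 := by simp [mode, hy]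
      rw [this]
      simp
  have hh : ‖(α * τ) • mode (Q k) (fun i => ∇ (f i) (avg x₀))‖ ^ 2
      = α ^ 2 * τ ^ 2 * ‖mode (Q k) (fun i => ∇ (f i) (avg x₀))‖ ^ 2 := by
    rw [norm_smul, mul_pow, Real.norm_eq_abs, sq_abs, mul_pow]
  have h2 := norm_add_sq_le_two (mode (Q k) y₀)
    ((α * τ) • mode (Q k) (fun i => ∇ (f i) (avg x₀)))
  rw [← hz, hh] at h2
  have h3 := mul_le_mul_of_nonneg_left h2 (show 0 ≤ dualWeight (d k) by linarith)
  have h4 := mul_le_mul_of_nonneg_right hal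
    (show 0 ≤ 2 * (α ^ 2 * τ ^ 2 * ‖mode (Q k) (fun i => ∇ (f i) (avg x₀))‖ ^ 2) by positivity)
  have h5 : 2 / (1 - mixingRate W)
        * (α ^ 2 * τ ^ 2 * ‖mode (Q k) (fun i => ∇ (f i) (avg x₀))‖ ^ 2)
      = 1 / (1 - mixingRate W)
        * (2 * (α ^ 2 * τ ^ 2 * ‖mode (Q k) (fun i => ∇ (f i) (avg x₀))‖ ^ 2)) := by
    field_simp
  rw [h5]
  linarith

end Trajectory
/-! ### Second moments -/

section Moments

variable {Ω : Type*} [MeasurableSpace Ω] {μ : Measure Ω}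

theorem integrable_inner_of_memLp {E : Type*} [NormedAddCommGroup E] [InnerProductSpace ℝ E]
    {u v : Ω → E} (hu : MemLp u 2 μ) (hv : MemLp v 2 μ) :
    Integrable (fun ω => inner ℝ (u ω) (v ω)) μ := by
  refine Integrable.mono' ((hu.integrable_norm_pow (p := 2) two_ne_zero).add
    (hv.integrable_norm_pow (p := 2) two_ne_zero)) (hu.1.inner hv.1) (ae_of_all _ fun ω => ?_)
  have h := norm_inner_le_norm (𝕜 := ℝ) (u ω) (v ω)
  simp only [Pi.add_apply]
  nlinarith [sq_nonneg (‖u ω‖ - ‖v ω‖), sq_nonneg (‖u ω‖ + ‖v ω‖)]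

/-- Pythagoras in L²: orthogonality makes the bound grow with the number of terms, not with its
square. -/
theorem integral_norm_sum_sq_le {E ι : Type*} [NormedAddCommGroup E] [InnerProductSpace ℝ E]
    (S : Finset ι) {v : ι → Ω → E} {c : ℝ} (hv : ∀ i ∈ S, MemLp (v i) 2 μ)
    (horth : ∀ i ∈ S, ∀ j ∈ S, i ≠ j → ∫ ω, inner ℝ (v i ω) (v j ω) ∂μ = 0)
    (hc : ∀ i ∈ S, ∫ ω, ‖v i ω‖ ^ 2 ∂μ ≤ c) :
    ∫ ω, ‖∑ i ∈ S, v i ω‖ ^ 2 ∂μ ≤ S.card * c := by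
  have e : ∀ ω, ‖∑ i ∈ S, v i ω‖ ^ 2 = ∑ i ∈ S, ∑ j ∈ S, inner ℝ (v i ω) (v j ω) := by
    intro ω
    rw [← real_inner_self_eq_norm_sq, sum_inner]
    simp_rw [inner_sum]
  simp_rw [e]
  rw [integral_finsetSum _ fun i hi => integrable_finsetSum _ fun j hj =>
    integrable_inner_of_memLp (hv i hi) (hv j hj), ← nsmul_eq_mul, ← Finset.sum_const]
  refine Finset.sum_le_sum fun i hi => ?_
  rw [integral_finsetSum _ fun j hj => integrable_inner_of_memLp (hv i hi) (hv j hj),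
    Finset.sum_eq_single_of_mem i hi fun j hj hji => horth i hi j hj hji.symm]
  simp_rw [real_inner_self_eq_norm_sq]
  exact hc i hi

end Moments

/-- If `F (φ, ζ)` has mean zero given `φ`, and `ζ` is independent of `(φ, Z)`, then `F (φ, ζ)` is
orthogonal to `Z`. -/
theorem integral_inner_eq_zero_of_indep {Ω Ξ : Type*} {m : ℕ} {𝒜 : MeasurableSpace Ω}
    [mΩ : MeasurableSpace Ω] [MeasurableSpace Ξ] {μ : Measure Ω} [IsProbabilityMeasure μ]
    (h𝒜 : 𝒜 ≤ mΩ) {ζ : Ω → Ξ} (hζ : Measurable ζ)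
    (hind : Indep 𝒜 (MeasurableSpace.comap ζ inferInstance) μ)
    {F : Vec m × Ξ → Vec m} (hF : Measurable F) {φ Z : Ω → Vec m}
    (hφ : Measurable[𝒜] φ) (hZ : Measurable[𝒜] Z)
    (hFL : MemLp (fun ω => F (φ ω, ζ ω)) 2 μ) (hZL : MemLp Z 2 μ)
    (h0 : ∀ B, MeasurableSet B → ∫ ω in φ ⁻¹' B, F (φ ω, ζ ω) ∂μ = 0) :
    ∫ ω, inner ℝ (Z ω) (F (φ ω, ζ ω)) ∂μ = 0 := by
  have hφm : Measurable φ := hφ.mono h𝒜 le_rfl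
  have hZm : Measurable Z := hZ.mono h𝒜 le_rfl
  have hpair : Measurable fun ω => (φ ω, Z ω) := hφm.prodMk hZm
  have hindφ : IndepFun φ ζ μ :=
    (IndepFun_iff_Indep _ _ _).2 (indep_of_indep_of_le_left hind hφ.comap_le)
  have hindp : IndepFun (fun ω => (φ ω, Z ω)) ζ μ :=
    (IndepFun_iff_Indep _ _ _).2 (indep_of_indep_of_le_left hind (hφ.prodMk hZ).comap_le)
  have mapφ := (indepFun_iff_map_prod_eq_prod_map_map hφm.aemeasurable hζ.aemeasurable).1 hindφ
  have mapp := (indepFun_iff_map_prod_eq_prod_map_map hpair.aemeasurable hζ.aemeasurable).1 hindp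
  have : IsProbabilityMeasure (μ.map φ) := Measure.isProbabilityMeasure_map hφm.aemeasurable
  have : IsProbabilityMeasure (μ.map ζ) := Measure.isProbabilityMeasure_map hζ.aemeasurable
  have : IsProbabilityMeasure (μ.map fun ω => (φ ω, Z ω)) :=
    Measure.isProbabilityMeasure_map hpair.aemeasurable
  have hφζ : Measurable fun ω => (φ ω, ζ ω) := hφm.prodMk hζ
  have hFint : Integrable F ((μ.map φ).prod (μ.map ζ)) := by
    rw [← mapφ, integrable_map_measure hF.aestronglyMeasurable hφζ.aemeasurable]
    exact hFL.integrable one_le_two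
  -- Independence makes the law of `(φ, ζ)` a product. The hypothesis on the events `φ ∈ B` says
  -- that the mean of `F (z, ·)` integrates to zero over every `B`, so it vanishes for almost every
  -- `z`.
  have hmean : (fun z => ∫ s, F (z, s) ∂(μ.map ζ)) =ᵐ[μ.map φ] 0 := by
    refine hFint.integral_prod_left.ae_eq_zero_of_forall_setIntegral_eq_zero fun B hB _ => ?_
    have h1 := setIntegral_prod (s := B) (t := Set.univ) F hFint.integrableOn
    simp only [Measure.restrict_univ] at h1
    rw [← h1, ← mapφ, setIntegral_map (hB.prod MeasurableSet.univ) hF.aestronglyMeasurable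
      hφζ.aemeasurable]
    convert h0 B hB using 3
    ext ω
    simp
  have hfst : μ.map φ = (μ.map fun ω => (φ ω, Z ω)).map Prod.fst := by
    rw [Measure.map_map measurable_fst hpair]
    rfl
  have hae : ∀ᵐ p ∂(μ.map fun ω => (φ ω, Z ω)),
      Integrable (fun s => F (p.1, s)) (μ.map ζ) ∧ ∫ s, F (p.1, s) ∂(μ.map ζ) = 0 := by
    refine ae_of_ae_map (f := Prod.fst) measurable_fst.aemeasurable
      (p := fun z => Integrable (fun s => F (z, s)) (μ.map ζ) ∧ ∫ s, F (z, s) ∂(μ.map ζ) = 0) ?_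
    rw [← hfst]
    filter_upwards [hFint.prod_right_ae, hmean] with z hz1 hz2 using ⟨hz1, hz2⟩
  -- By Fubini, integrating over `ζ` first with `(φ, Z)` frozen leaves the inner product of `Z` with
  -- that zero mean.
  set K : (Vec m × Vec m) × Ξ → ℝ := fun p => inner ℝ p.1.2 (F (p.1.1, p.2)) with hK
  have hKm : Measurable K := (measurable_snd.comp measurable_fst).inner
    (hF.comp ((measurable_fst.comp measurable_fst).prodMk measurable_snd))
  have htriple : Measurable fun ω => ((φ ω, Z ω), ζ ω) := hpair.prodMk hζ
  have hKint : Integrable K ((μ.map fun ω => (φ ω, Z ω)).prod (μ.map ζ)) := by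
    rw [← mapp, integrable_map_measure hKm.aestronglyMeasurable htriple.aemeasurable]
    exact integrable_inner_of_memLp hZL hFL
  calc ∫ ω, inner ℝ (Z ω) (F (φ ω, ζ ω)) ∂μ
      = ∫ p, K p ∂(μ.map fun ω => ((φ ω, Z ω), ζ ω)) :=
        (integral_map htriple.aemeasurable hKm.aestronglyMeasurable).symm
    _ = ∫ p, ∫ s, K (p, s) ∂(μ.map ζ) ∂(μ.map fun ω => (φ ω, Z ω)) := by
        rw [mapp, integral_prod _ hKint]
    _ = 0 := by
        refine integral_eq_zero_of_ae ?_
        filter_upwards [hae] with p hp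
        simp only [hK]
        rw [integral_inner hp.1, hp.2, inner_zero_right]
        rfl

/-! ### The iterates as random variables -/

section Iterates

variable {N m : ℕ} {Ξ Ω : Type*} {W : Matrix (Fin N) (Fin N) ℝ} {f : Fin N → Vec m → ℝ}
  {G : Fin N → Vec m → Ξ → Vec m} {τ : ℕ} {α β : ℝ} {x₀ y₀ : Fin N → Vec m}
  {ξ : ℕ → ℕ → Fin N → Ω → Ξ}

/-- The σ-algebra on `Ω` is arbitrary and only the data actually used must be measurable. Applied to
the σ-algebra of all data but one, this shows that an iterate does not depend on the omitted datum.
-/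
theorem measurable_localUpdates [MeasurableSpace Ω] [MeasurableSpace Ξ]
    (hG : ∀ i, Measurable fun p : Vec m × Ξ => G i p.1 p.2) {ζ : ℕ → Fin N → Ω → Ξ} {t : ℕ}
    (hζ : ∀ s < t, ∀ i, Measurable (ζ s i)) {x y : Ω → Fin N → Vec m}
    (hx : ∀ i, Measurable fun ω => x ω i) (hy : ∀ i, Measurable fun ω => y ω i) (i : Fin N) :
    Measurable fun ω => localUpdates G α β (fun s j => ζ s j ω) (x ω) (y ω) t i := by
  induction t generalizing i with
  | zero => exact hx i
  | succ t ih =>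
    have h1 := ih (fun s hs => hζ s (hs.trans (Nat.lt_succ_self t)))
    exact ((h1 i).sub (((hG i).comp ((h1 i).prodMk (hζ t (Nat.lt_succ_self t) i))).const_smul α)).sub
      ((hy i).const_smul β)

theorem measurable_state [MeasurableSpace Ω] [MeasurableSpace Ξ]
    (hG : ∀ i, Measurable fun p : Vec m × Ξ => G i p.1 p.2) {r : ℕ}
    (hξ : ∀ q < r, ∀ s < τ, ∀ i, Measurable (ξ q s i)) (i : Fin N) :
    Measurable (fun ω => (state W G τ α β x₀ y₀ (path ξ ω) r).1 i) ∧
      Measurable (fun ω => (state W G τ α β x₀ y₀ (path ξ ω) r).2 i) := by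
  induction r generalizing i with
  | zero => exact ⟨measurable_const, measurable_const⟩
  | succ r ih =>
    have h1 := ih fun q hq => hξ q (hq.trans (Nat.lt_succ_self r))
    have h2 : ∀ i, Measurable fun ω => localUpdates G α β (path ξ ω r)
        (state W G τ α β x₀ y₀ (path ξ ω) r).1 (state W G τ α β x₀ y₀ (path ξ ω) r).2 τ i :=
      measurable_localUpdates hG (hξ r (Nat.lt_succ_self r)) (fun i => (h1 i).1) fun i => (h1 i).2
    have h3 : Measurable fun ω => (state W G τ α β x₀ y₀ (path ξ ω) (r + 1)).1 i :=
      Finset.measurable_fun_sum Finset.univ fun j _ => (h2 j).fun_const_smul (W i j)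
    exact ⟨h3, ((h1 i).2.add (h2 i)).sub h3⟩

theorem measurable_phi [MeasurableSpace Ω] [MeasurableSpace Ξ]
    (hG : ∀ i, Measurable fun p : Vec m × Ξ => G i p.1 p.2) {r t : ℕ}
    (hξ : ∀ q < r, ∀ s < τ, ∀ i, Measurable (ξ q s i)) (hr : ∀ s < t, ∀ i, Measurable (ξ r s i))
    (i : Fin N) : Measurable fun ω => phi W G τ α β x₀ y₀ (path ξ ω) r t i :=
  measurable_localUpdates hG hr (fun i => (measurable_state hG hξ i).1)
    (fun i => (measurable_state hG hξ i).2) i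

theorem IsSmoothObjective.continuous_gradient {L : ℝ} (hf : IsSmoothObjective f L) (i : Fin N) :
    Continuous (∇ (f i)) :=
  (LipschitzWith.of_dist_le_mul (K := L.toNNReal) fun y z => by
    rw [dist_eq_norm, dist_eq_norm, Real.coe_toNNReal _ hf.pos.le]
    exact hf.lipschitz i y z).continuous

theorem IsSmoothObjective.memLp_gradient [MeasurableSpace Ω] {μ : Measure Ω}
    [IsFiniteMeasure μ] {L : ℝ} (hf : IsSmoothObjective f L) (i : Fin N) {u : Ω → Vec m}
    (hu : MemLp u 2 μ) : MemLp (fun ω => ∇ (f i) (u ω)) 2 μ := by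
  have h1 : LipschitzWith L.toNNReal fun z => ∇ (f i) z - ∇ (f i) 0 :=
    LipschitzWith.of_dist_le_mul fun y z => by
      rw [dist_eq_norm, dist_eq_norm, Real.coe_toNNReal _ hf.pos.le, sub_sub_sub_cancel_right]
      exact hf.lipschitz i y z
  have h2 := (h1.comp_memLp (sub_self _) hu).add (memLp_const (∇ (f i) 0))
  refine h2.ae_eq (ae_of_all _ fun ω => ?_)
  simp

theorem memLp_avg [MeasurableSpace Ω] {μ : Measure Ω} {u : Fin N → Ω → Vec m}
    (hu : ∀ i, MemLp (u i) 2 μ) : MemLp (fun ω => avg fun i => u i ω) 2 μ :=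
  (memLp_finsetSum Finset.univ fun i _ => hu i).const_smul (1 / (N : ℝ))

end Iterates
/-! ### Upper bounds on expectations -/

/-- `X` is integrable with expectation at most `c`. -/
def MeanLE {Ω : Type*} [MeasurableSpace Ω] (μ : Measure Ω) (X : Ω → ℝ) (c : ℝ) : Prop :=
  Integrable X μ ∧ ∫ ω, X ω ∂μ ≤ c

namespace MeanLE

variable {Ω : Type*} [MeasurableSpace Ω] {μ : Measure Ω} {X Y : Ω → ℝ} {a b : ℝ}

theorem add (hX : MeanLE μ X a) (hY : MeanLE μ Y b) : MeanLE μ (fun ω => X ω + Y ω) (a + b) :=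
  ⟨hX.1.add hY.1, by rw [integral_add hX.1 hY.1]; exact add_le_add hX.2 hY.2⟩

theorem const_mul (hX : MeanLE μ X a) {c : ℝ} (hc : 0 ≤ c) :
    MeanLE μ (fun ω => c * X ω) (c * a) :=
  ⟨hX.1.const_mul c, by rw [integral_const_mul]; exact mul_le_mul_of_nonneg_left hX.2 hc⟩

theorem sum {ι : Type*} (S : Finset ι) {X : ι → Ω → ℝ} {a : ι → ℝ}
    (h : ∀ i ∈ S, MeanLE μ (X i) (a i)) : MeanLE μ (fun ω => ∑ i ∈ S, X i ω) (∑ i ∈ S, a i) :=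
  ⟨integrable_finsetSum _ fun i hi => (h i hi).1, by
    rw [integral_finsetSum _ fun i hi => (h i hi).1]
    exact Finset.sum_le_sum fun i hi => (h i hi).2⟩

theorem const [IsProbabilityMeasure μ] (c : ℝ) : MeanLE μ (fun _ => c) c :=
  ⟨integrable_const c, by simp⟩

theorem mono (hX : MeanLE μ X a) (hab : a ≤ b) : MeanLE μ X b := ⟨hX.1, hX.2.trans hab⟩

theorem sub_const_mul (hX : MeanLE μ X a) (hY : Integrable Y μ) (h0 : ∫ ω, Y ω ∂μ = 0) (c : ℝ) :
    MeanLE μ (fun ω => X ω - c * Y ω) a :=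
  ⟨hX.1.sub (hY.const_mul c), by
    rw [integral_sub hX.1 (hY.const_mul c), integral_const_mul, h0, mul_zero, sub_zero]
    exact hX.2⟩

end MeanLE

/-! ### The gradient noise -/

theorem memLp_mode {N m : ℕ} {Ω : Type*} [MeasurableSpace Ω] {μ : Measure Ω} (q : Fin N → ℝ)
    {u : Fin N → Ω → Vec m} (hu : ∀ i, MemLp (u i) 2 μ) :
    MemLp (fun ω => mode q fun i => u i ω) 2 μ :=
  memLp_finsetSum Finset.univ fun i _ => (hu i).const_smul (q i)

theorem measurable_avg {N m : ℕ} {Ω : Type*} [MeasurableSpace Ω] {u : Fin N → Ω → Vec m}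
    (hu : ∀ i, Measurable (u i)) : Measurable fun ω => avg fun i => u i ω :=
  (Finset.measurable_fun_sum Finset.univ fun i _ => hu i).fun_const_smul (1 / (N : ℝ))

/-- The σ-algebra generated by all data except the datum `p₀`. -/
@[reducible] def otherData {N : ℕ} {Ξ Ω : Type*} [MeasurableSpace Ξ] (τ : ℕ)
    (ξ : ℕ → ℕ → Fin N → Ω → Ξ) (p₀ : ℕ × Fin τ × Fin N) : MeasurableSpace Ω :=
  ⨆ p ∈ {p : ℕ × Fin τ × Fin N | p ≠ p₀},
    MeasurableSpace.comap (ξ p.1 p.2.1 p.2.2) inferInstance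

theorem measurable_otherData {N : ℕ} {Ξ Ω : Type*} [MeasurableSpace Ξ] {τ : ℕ}
    {ξ : ℕ → ℕ → Fin N → Ω → Ξ} {p₀ : ℕ × Fin τ × Fin N} {q s : ℕ} {j : Fin N} (hs : s < τ)
    (hne : (q, ⟨s, hs⟩, j) ≠ p₀) : Measurable[otherData τ ξ p₀] (ξ q s j) :=
  measurable_iff_comap_le.2 (le_iSup₂_of_le (f := fun (p : ℕ × Fin τ × Fin N)
    (_ : p ∈ {p : ℕ × Fin τ × Fin N | p ≠ p₀}) =>
      MeasurableSpace.comap (ξ p.1 p.2.1 p.2.2) inferInstance) (q, ⟨s, hs⟩, j) hne le_rfl)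

section Noise

variable {N m : ℕ} {Ξ Ω : Type*} {W : Matrix (Fin N) (Fin N) ℝ} {f : Fin N → Vec m → ℝ}
  {G : Fin N → Vec m → Ξ → Vec m} {τ : ℕ} {α β : ℝ} {x₀ y₀ : Fin N → Vec m}
  {ξ : ℕ → ℕ → Fin N → Ω → Ξ} {L σ : ℝ}

theorem phi_succ (r t : ℕ) (i : Fin N) (ω : Ω) :
    phi W G τ α β x₀ y₀ (path ξ ω) r (t + 1) i
      = phi W G τ α β x₀ y₀ (path ξ ω) r t i
        - α • (∇ (f i) (phi W G τ α β x₀ y₀ (path ξ ω) r t i)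
          + noise W f G τ α β x₀ y₀ ξ r t i ω)
        - β • (state W G τ α β x₀ y₀ (path ξ ω) r).2 i := by
  rw [noise, add_sub_cancel]
  rfl

theorem isRound (hW : IsWeightMatrix W) (hβ : β = 1 / (τ : ℝ))
    (hy : ∑ i, y₀ i = 0) (ω : Ω) (r : ℕ) :
    IsRound W (fun i => ∇ (f i)) τ α (fun t i => noise W f G τ α β x₀ y₀ ξ r t i ω)
      (phi W G τ α β x₀ y₀ (path ξ ω) r)
      (state W G τ α β x₀ y₀ (path ξ ω) r).1 (state W G τ α β x₀ y₀ (path ξ ω) r).2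
      (state W G τ α β x₀ y₀ (path ξ ω) (r + 1)).1
      (state W G τ α β x₀ y₀ (path ξ ω) (r + 1)).2 := by
  have key : ∀ r, ∑ i, (state W G τ α β x₀ y₀ (path ξ ω) r).2 i = 0 →
      IsRound W (fun i => ∇ (f i)) τ α (fun t i => noise W f G τ α β x₀ y₀ ξ r t i ω)
      (phi W G τ α β x₀ y₀ (path ξ ω) r)
      (state W G τ α β x₀ y₀ (path ξ ω) r).1 (state W G τ α β x₀ y₀ (path ξ ω) r).2
      (state W G τ α β x₀ y₀ (path ξ ω) (r + 1)).1
      (state W G τ α β x₀ y₀ (path ξ ω) (r + 1)).2 := fun r hr =>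
    { zero := rfl
      succ := fun t i => by rw [← hβ]; exact phi_succ r t i ω
      primal := fun i => rfl
      dual := fun i => rfl
      sum_dual := hr }
  refine key r ?_
  induction r with
  | zero => exact hy
  | succ r ih => exact (key r ih).sum_dual_next hW

theorem measurable_dualError_state [MeasurableSpace Ω] [MeasurableSpace Ξ]
    (hf : IsSmoothObjective f L) (hG : ∀ i, Measurable fun p : Vec m × Ξ => G i p.1 p.2) {r : ℕ}
    (hξ : ∀ q < r, ∀ s < τ, ∀ i, Measurable (ξ q s i)) (i : Fin N) :
    Measurable fun ω => dualError (fun i => ∇ (f i)) τ α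
      (state W G τ α β x₀ y₀ (path ξ ω) r).1 (state W G τ α β x₀ y₀ (path ξ ω) r).2 i :=
  (measurable_state hG hξ i).2.add (((hf.continuous_gradient i).measurable.comp
    (measurable_avg fun j => (measurable_state hG hξ j).1)).const_smul (α * τ))

theorem measurable_noise [MeasurableSpace Ω] [MeasurableSpace Ξ]
    (hf : IsSmoothObjective f L) (hG : ∀ i, Measurable fun p : Vec m × Ξ => G i p.1 p.2) {r t : ℕ}
    (hξ : ∀ q < r, ∀ s < τ, ∀ i, Measurable (ξ q s i)) (hr : ∀ s < t, ∀ i, Measurable (ξ r s i))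
    {i : Fin N} (hi : Measurable (ξ r t i)) :
    Measurable (noise W f G τ α β x₀ y₀ ξ r t i) :=
  ((hG i).comp ((measurable_phi hG hξ hr i).prodMk hi)).sub
    ((hf.continuous_gradient i).measurable.comp (measurable_phi hG hξ hr i))

namespace IsBoundedNoise

variable [MeasurableSpace Ξ] [mΩ : MeasurableSpace Ω] {μ : Measure Ω} [IsProbabilityMeasure μ]

omit [IsProbabilityMeasure μ] in
theorem past_le (h : IsBoundedNoise μ W f G τ α β x₀ y₀ ξ σ) {r t : ℕ} (ht : t ≤ τ) :
    past W G τ α β x₀ y₀ ξ r t ≤ mΩ := by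
  refine iSup_le fun q => iSup_le fun s => iSup_le fun hqs => iSup_le fun j => ?_
  have hs : s ≤ τ := by rcases hqs with h | h <;> omega
  exact (measurable_phi h.measurable_grad
    (fun q _ s hs i => h.measurable_data q s i hs)
    (fun s' hs' i => h.measurable_data q s' i (hs'.trans_le hs)) j).comap_le

/-- Square integrability propagates because Lipschitz gradients grow at most linearly and the noise
is in L². It makes every inner product below integrable. -/
theorem memLp_iterates (h : IsBoundedNoise μ W f G τ α β x₀ y₀ ξ σ)
    (hf : IsSmoothObjective f L) (r : ℕ) :
    (∀ i, MemLp (fun ω => (state W G τ α β x₀ y₀ (path ξ ω) r).1 i) 2 μ) ∧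
      (∀ i, MemLp (fun ω => (state W G τ α β x₀ y₀ (path ξ ω) r).2 i) 2 μ) ∧
      ∀ t ≤ τ, ∀ i, MemLp (fun ω => phi W G τ α β x₀ y₀ (path ξ ω) r t i) 2 μ := by
  have key : ∀ r, (∀ i, MemLp (fun ω => (state W G τ α β x₀ y₀ (path ξ ω) r).1 i) 2 μ) →
      (∀ i, MemLp (fun ω => (state W G τ α β x₀ y₀ (path ξ ω) r).2 i) 2 μ) →
      ∀ t ≤ τ, ∀ i, MemLp (fun ω => phi W G τ α β x₀ y₀ (path ξ ω) r t i) 2 μ := by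
    intro r hx hy t
    induction t with
    | zero => exact fun _ i => hx i
    | succ t ih =>
      intro ht i
      have h1 := ih (by omega) i
      simp_rw [phi_succ (f := f)]
      exact (h1.sub (((hf.memLp_gradient i h1).add (h.memLp r t i ht)).const_smul α)).sub
        ((hy i).const_smul β)
  induction r with
  | zero =>
    have hx : ∀ i, MemLp (fun ω => (state W G τ α β x₀ y₀ (path ξ ω) 0).1 i) 2 μ :=
      fun i => memLp_const (x₀ i)
    have hy : ∀ i, MemLp (fun ω => (state W G τ α β x₀ y₀ (path ξ ω) 0).2 i) 2 μ :=
      fun i => memLp_const (y₀ i)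
    exact ⟨hx, hy, key 0 hx hy⟩
  | succ r ih =>
    have hφ := ih.2.2 τ le_rfl
    have hx : ∀ i, MemLp (fun ω => (state W G τ α β x₀ y₀ (path ξ ω) (r + 1)).1 i) 2 μ :=
      fun i => memLp_finsetSum Finset.univ fun j _ => (hφ j).const_smul (W i j)
    have hy : ∀ i, MemLp (fun ω => (state W G τ α β x₀ y₀ (path ξ ω) (r + 1)).2 i) 2 μ :=
      fun i => ((ih.2.1 i).add (hφ i)).sub (hx i)
    exact ⟨hx, hy, key (r + 1) hx hy⟩

theorem memLp_dualError (h : IsBoundedNoise μ W f G τ α β x₀ y₀ ξ σ)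
    (hf : IsSmoothObjective f L) (r : ℕ) (i : Fin N) :
    MemLp (fun ω => dualError (fun i => ∇ (f i)) τ α
      (state W G τ α β x₀ y₀ (path ξ ω) r).1 (state W G τ α β x₀ y₀ (path ξ ω) r).2 i) 2 μ :=
  ((h.memLp_iterates hf r).2.1 i).add
    ((hf.memLp_gradient i (memLp_avg (h.memLp_iterates hf r).1)).const_smul (α * τ))

theorem integral_norm_sq_le (h : IsBoundedNoise μ W f G τ α β x₀ y₀ ξ σ) {r t : ℕ} (ht : t < τ)
    (i : Fin N) : ∫ ω, ‖noise W f G τ α β x₀ y₀ ξ r t i ω‖ ^ 2 ∂μ ≤ σ ^ 2 := by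
  rw [← integral_condExp (h.past_le (r := r) ht.le)]
  refine (integral_mono_ae integrable_condExp (integrable_const _) (h.variance_le r t i ht)).trans
    ?_
  simp

/-- The noise of one node at one step is orthogonal to every function of the other data. -/
theorem integral_inner_eq_zero (h : IsBoundedNoise μ W f G τ α β x₀ y₀ ξ σ)
    (hf : IsSmoothObjective f L) {r t : ℕ} (ht : t < τ) (i : Fin N) {Z : Ω → Vec m}
    (hZ : Measurable[otherData τ ξ (r, ⟨t, ht⟩, i)] Z) (hZL : MemLp Z 2 μ) :
    ∫ ω, inner ℝ (Z ω) (noise W f G τ α β x₀ y₀ ξ r t i ω) ∂μ = 0 := by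
  have hle : ∀ p : ℕ × Fin τ × Fin N,
      MeasurableSpace.comap (ξ p.1 p.2.1 p.2.2) inferInstance ≤ mΩ :=
    fun p => (h.measurable_data p.1 p.2.1 p.2.2 p.2.1.2).comap_le
  -- The iterate uses only data of earlier rounds and earlier local steps, never the datum `(r, t,
  -- i)`.
  have hφ : Measurable[otherData τ ξ (r, ⟨t, ht⟩, i)]
      fun ω => phi W G τ α β x₀ y₀ (path ξ ω) r t i := by
    refine @measurable_phi _ _ _ _ _ _ _ _ _ _ _ _ (otherData τ ξ (r, ⟨t, ht⟩, i)) _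
      h.measurable_grad r t (fun q hq s hs j => measurable_otherData hs ?_)
      (fun s hs j => measurable_otherData (hs.trans ht) ?_) i
    · simp only [ne_eq, Prod.mk.injEq, not_and]
      omega
    · simp only [ne_eq, Prod.mk.injEq, Fin.mk.injEq, not_and]
      omega
  have hind := indep_iSup_of_disjoint hle ((iIndepFun_iff_iIndep _ _ _).1 h.indep)
    (S := {p : ℕ × Fin τ × Fin N | p ≠ (r, ⟨t, ht⟩, i)}) (T := {(r, ⟨t, ht⟩, i)})
    (by simp)
  rw [iSup_singleton] at hind
  refine integral_inner_eq_zero_of_indep (𝒜 := otherData τ ξ (r, ⟨t, ht⟩, i))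
    (F := fun p => G i p.1 p.2 - ∇ (f i) p.1) (φ := fun ω => phi W G τ α β x₀ y₀ (path ξ ω) r t i)
    (iSup₂_le fun p _ => hle p) (h.measurable_data r t i ht) hind
    ((h.measurable_grad i).sub ((hf.continuous_gradient i).measurable.comp measurable_fst))
    hφ hZ (h.memLp r t i ht) hZL fun B hB => ?_
  -- Conditional unbiasedness is needed only on events determined by the current iterate of node
  -- `i`, and these belong to the past.
  have hpast : MeasurableSet[past W G τ α β x₀ y₀ ξ r t]
      ((fun ω => phi W G τ α β x₀ y₀ (path ξ ω) r t i) ⁻¹' B) := by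
    have hle' : MeasurableSpace.comap (fun ω => phi W G τ α β x₀ y₀ (path ξ ω) r t i) inferInstance
        ≤ past W G τ α β x₀ y₀ ξ r t :=
      le_iSup_of_le r (le_iSup_of_le t (le_iSup_of_le (Or.inr ⟨rfl, le_rfl⟩)
        (le_iSup_of_le i le_rfl)))
    exact hle' _ ⟨B, hB, rfl⟩
  have h1 := setIntegral_condExp (h.past_le (r := r) ht.le)
    ((h.memLp r t i ht).integrable one_le_two) hpast
  rw [integral_eq_zero_of_ae (ae_restrict_of_ae (h.unbiased r t i ht))] at h1
  exact h1.symm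

/-- Dependence on earlier rounds only is expressed by quantifying over all σ-algebras that make
those data measurable, the form the measurability lemmas for the iterates deliver. -/
theorem integral_inner_before_eq_zero (h : IsBoundedNoise μ W f G τ α β x₀ y₀ ξ σ)
    (hf : IsSmoothObjective f L) {r t : ℕ} (ht : t < τ) (i : Fin N) {Z : Ω → Vec m}
    (hZ : ∀ 𝒜 : MeasurableSpace Ω,
      (∀ q < r, ∀ s < τ, ∀ j, Measurable[𝒜] (ξ q s j)) → Measurable[𝒜] Z)
    (hZL : MemLp Z 2 μ) :
    ∫ ω, inner ℝ (Z ω) (noise W f G τ α β x₀ y₀ ξ r t i ω) ∂μ = 0 := by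
  refine h.integral_inner_eq_zero hf ht i (hZ _ fun q hq s hs j => measurable_otherData hs ?_) hZL
  simp only [ne_eq, Prod.mk.injEq, not_and]
  omega

theorem integral_inner_noise_noise (h : IsBoundedNoise μ W f G τ α β x₀ y₀ ξ σ)
    (hf : IsSmoothObjective f L) (r : ℕ) {t t' : ℕ} (ht : t < τ) (ht' : t' < τ) {i j : Fin N}
    (hne : t = t' → i ≠ j) :
    ∫ ω, inner ℝ (noise W f G τ α β x₀ y₀ ξ r t i ω) (noise W f G τ α β x₀ y₀ ξ r t' j ω) ∂μ
      = 0 := by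
  -- The noise at the later step is the one integrated out; the other involves data of steps up to
  -- `t` and, at step `t`, only the datum of node `i`.
  wlog hle : t ≤ t' generalizing t t' i j
  · simp_rw [real_inner_comm (noise W f G τ α β x₀ y₀ ξ r t' j _)]
    exact this ht' ht (fun e => (hne e.symm).symm) (by omega)
  refine h.integral_inner_eq_zero hf ht' j ?_ (h.memLp r t i ht)
  have hG := h.measurable_grad
  refine @measurable_noise _ _ _ _ _ _ _ _ _ _ _ _ _ _ (otherData τ ξ (r, ⟨t', ht'⟩, j)) _
    hf hG r t (fun q hq s hs j => measurable_otherData hs ?_)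
    (fun s hs j => measurable_otherData (hs.trans ht) ?_) i (measurable_otherData ht ?_)
  · simp only [ne_eq, Prod.mk.injEq, not_and]
    omega
  · simp only [ne_eq, Prod.mk.injEq, Fin.mk.injEq, not_and]
    omega
  · simp only [ne_eq, Prod.mk.injEq, Fin.mk.injEq, not_and]
    exact fun _ e => hne e

theorem meanLE_accNoise (h : IsBoundedNoise μ W f G τ α β x₀ y₀ ξ σ)
    (hf : IsSmoothObjective f L) (r : ℕ) {t : ℕ} (ht : t ≤ τ) :
    MeanLE μ (fun ω => accNoise (fun t i => noise W f G τ α β x₀ y₀ ξ r t i ω) t)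
      (N * (τ * σ ^ 2)) := by
  have hlt : ∀ l ∈ Finset.range t, l < τ := fun l hl => (Finset.mem_range.1 hl).trans_le ht
  have hi : ∀ i ∈ Finset.univ, MeanLE μ
      (fun ω => ‖∑ l ∈ Finset.range t, noise W f G τ α β x₀ y₀ ξ r l i ω‖ ^ 2)
      (τ * σ ^ 2) := fun i _ => by
    refine ⟨(memLp_finsetSum _ fun l hl => h.memLp r l i (hlt l hl)).integrable_norm_pow
      (p := 2) two_ne_zero, ?_⟩
    refine (integral_norm_sum_sq_le _ (fun l hl => h.memLp r l i (hlt l hl))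
      (fun l hl l' hl' hne => h.integral_inner_noise_noise hf r (hlt l hl) (hlt l' hl')
        fun e => absurd e hne) fun l hl => h.integral_norm_sq_le (hlt l hl) i).trans ?_
    rw [Finset.card_range]
    gcongr
  refine (MeanLE.sum Finset.univ hi).mono (le_of_eq ?_)
  simp

/-- All `τN` noises of a round are pairwise orthogonal, so the factor `1/N²` of the squared average
meets only `τN` terms. This is the source of the linear speedup in `N`. -/
theorem meanLE_norm_sum_avg (hN : 0 < N) (h : IsBoundedNoise μ W f G τ α β x₀ y₀ ξ σ)
    (hf : IsSmoothObjective f L) (r : ℕ) :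
    MeanLE μ (fun ω => ‖∑ t ∈ Finset.range τ,
      avg fun i => noise W f G τ α β x₀ y₀ ξ r t i ω‖ ^ 2) (τ * σ ^ 2 / N) := by
  have hNR : (0 : ℝ) < N := by exact_mod_cast hN
  set S := Finset.range τ ×ˢ (Finset.univ : Finset (Fin N)) with hS
  set v : ℕ × Fin N → Ω → Vec m := fun p => noise W f G τ α β x₀ y₀ ξ r p.1 p.2 with hv
  have hlt : ∀ p ∈ S, p.1 < τ := fun p hp => Finset.mem_range.1 (Finset.mem_product.1 hp).1
  have hvL : ∀ p ∈ S, MemLp (v p) 2 μ := fun p hp => h.memLp r p.1 p.2 (hlt p hp)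
  have horth : ∀ p ∈ S, ∀ p' ∈ S, p ≠ p' → ∫ ω, inner ℝ (v p ω) (v p' ω) ∂μ = 0 :=
    fun p hp p' hp' hne => h.integral_inner_noise_noise hf r (hlt p hp) (hlt p' hp')
      fun e e' => hne (Prod.ext e e')
  have hvar : ∀ p ∈ S, ∫ ω, ‖v p ω‖ ^ 2 ∂μ ≤ σ ^ 2 :=
    fun p hp => h.integral_norm_sq_le (hlt p hp) p.2
  have hcard : (S.card : ℝ) = τ * N := by simp [hS]
  have hp : MeanLE μ (fun ω => ‖∑ p ∈ S, v p ω‖ ^ 2) (τ * N * σ ^ 2) := by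
    refine ⟨(memLp_finsetSum S hvL).integrable_norm_pow (p := 2) two_ne_zero, ?_⟩
    rw [← hcard]
    exact integral_norm_sum_sq_le S hvL horth hvar
  have e : (fun ω => ‖∑ t ∈ Finset.range τ,
      avg fun i => noise W f G τ α β x₀ y₀ ξ r t i ω‖ ^ 2)
      = fun ω => (1 / (N : ℝ)) ^ 2 * ‖∑ p ∈ S, v p ω‖ ^ 2 := by
    funext ω
    simp only [avg]
    rw [← Finset.smul_sum, norm_smul, mul_pow, Real.norm_of_nonneg (by positivity), hS,
      Finset.sum_product]
  rw [e]
  refine (hp.const_mul (by positivity)).mono (le_of_eq ?_)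
  field_simp

omit [IsProbabilityMeasure μ] in
theorem integral_inner_mode_eq_zero (h : IsBoundedNoise μ W f G τ α β x₀ y₀ ξ σ) {r : ℕ}
    (q : Fin N → ℝ) {u : Fin N → Ω → Vec m} (hu : ∀ i, MemLp (u i) 2 μ)
    (h0 : ∀ i, ∀ t < τ, ∀ j, ∫ ω, inner ℝ (u i ω) (noise W f G τ α β x₀ y₀ ξ r t j ω) ∂μ = 0) :
    ∫ ω, inner ℝ (mode q fun i => u i ω)
      (mode q fun j => ∑ t ∈ Finset.range τ, noise W f G τ α β x₀ y₀ ξ r t j ω) ∂μ = 0 := by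
  have hint : ∀ i, ∀ t ∈ Finset.range τ, ∀ j,
      Integrable (fun ω => inner ℝ (u i ω) (noise W f G τ α β x₀ y₀ ξ r t j ω)) μ :=
    fun i t ht j => integrable_inner_of_memLp (hu i) (h.memLp r t j (Finset.mem_range.1 ht))
  simp_rw [inner_mode_mode, inner_sum]
  have hint' : ∀ i j, Integrable (fun ω => q i * q j * ∑ t ∈ Finset.range τ,
      inner ℝ (u i ω) (noise W f G τ α β x₀ y₀ ξ r t j ω)) μ := fun i j =>
    (integrable_finsetSum _ fun t ht => hint i t ht j).const_mul _
  rw [integral_finsetSum _ fun i _ => integrable_finsetSum _ fun j _ => hint' i j]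
  refine Finset.sum_eq_zero fun i _ => ?_
  rw [integral_finsetSum _ fun j _ => hint' i j]
  refine Finset.sum_eq_zero fun j _ => ?_
  rw [integral_const_mul, integral_finsetSum _ fun t ht => hint i t ht j,
    Finset.sum_eq_zero fun t ht => h0 i t (Finset.mem_range.1 ht) j, mul_zero]

omit [IsProbabilityMeasure μ] in
theorem memLp_sum_noise (h : IsBoundedNoise μ W f G τ α β x₀ y₀ ξ σ) (r : ℕ) (j : Fin N) :
    MemLp (fun ω => ∑ t ∈ Finset.range τ, noise W f G τ α β x₀ y₀ ξ r t j ω) 2 μ :=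
  memLp_finsetSum _ fun t ht => h.memLp r t j (Finset.mem_range.1 ht)

/-- The state and dual error at the start of round `r` depend only on data of earlier rounds, hence
are orthogonal to each noise of the round. -/
theorem lyapunovNoise_mean (h : IsBoundedNoise μ W f G τ α β x₀ y₀ ξ σ)
    (hf : IsSmoothObjective f L) (Q : Fin N → Fin N → ℝ) (d : Fin N → ℝ) (r : ℕ) :
    Integrable (fun ω => lyapunovNoise Q d (fun i => ∇ (f i)) τ α
        (state W G τ α β x₀ y₀ (path ξ ω) r).1 (state W G τ α β x₀ y₀ (path ξ ω) r).2
        fun j => ∑ t ∈ Finset.range τ, noise W f G τ α β x₀ y₀ ξ r t j ω) μ ∧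
      ∫ ω, lyapunovNoise Q d (fun i => ∇ (f i)) τ α
        (state W G τ α β x₀ y₀ (path ξ ω) r).1 (state W G τ α β x₀ y₀ (path ξ ω) r).2
        (fun j => ∑ t ∈ Finset.range τ, noise W f G τ α β x₀ y₀ ξ r t j ω) ∂μ = 0 := by
  have hG := h.measurable_grad
  have hx := (h.memLp_iterates hf r).1
  have hz := h.memLp_dualError hf r
  have ix : ∀ k, Integrable (fun ω => inner ℝ
      (mode (Q k) (state W G τ α β x₀ y₀ (path ξ ω) r).1)
      (mode (Q k) fun j => ∑ t ∈ Finset.range τ, noise W f G τ α β x₀ y₀ ξ r t j ω)) μ := fun k =>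
    integrable_inner_of_memLp (memLp_mode (Q k) hx) (memLp_mode (Q k) (h.memLp_sum_noise r))
  have iz : ∀ k, Integrable (fun ω => inner ℝ
      (mode (Q k) (dualError (fun i => ∇ (f i)) τ α
        (state W G τ α β x₀ y₀ (path ξ ω) r).1 (state W G τ α β x₀ y₀ (path ξ ω) r).2))
      (mode (Q k) fun j => ∑ t ∈ Finset.range τ, noise W f G τ α β x₀ y₀ ξ r t j ω)) μ := fun k =>
    integrable_inner_of_memLp (memLp_mode (Q k) hz) (memLp_mode (Q k) (h.memLp_sum_noise r))
  have hint : ∀ k ∈ IsSpectralBasis.directions d, Integrable (fun ω =>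
      (1 + d k ^ 2) * inner ℝ (mode (Q k) (state W G τ α β x₀ y₀ (path ξ ω) r).1)
        (mode (Q k) fun j => ∑ t ∈ Finset.range τ, noise W f G τ α β x₀ y₀ ξ r t j ω)
      + d k * (1 - d k) * inner ℝ (mode (Q k) (dualError (fun i => ∇ (f i)) τ α
        (state W G τ α β x₀ y₀ (path ξ ω) r).1 (state W G τ α β x₀ y₀ (path ξ ω) r).2))
      (mode (Q k) fun j => ∑ t ∈ Finset.range τ, noise W f G τ α β x₀ y₀ ξ r t j ω)) μ :=
    fun k _ => ((ix k).const_mul _).add ((iz k).const_mul _)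
  simp only [lyapunovNoise]
  refine ⟨integrable_finsetSum _ hint, ?_⟩
  rw [integral_finsetSum _ hint]
  refine Finset.sum_eq_zero fun k _ => ?_
  rw [integral_add ((ix k).const_mul _) ((iz k).const_mul _), integral_const_mul,
    integral_const_mul, h.integral_inner_mode_eq_zero (Q k) hx fun i t ht j =>
      h.integral_inner_before_eq_zero hf ht j
        (fun 𝒜 h𝒜 => (measurable_state hG h𝒜 i).1) (hx i),
    h.integral_inner_mode_eq_zero (Q k) hz fun i t ht j =>
      h.integral_inner_before_eq_zero hf ht j
        (fun 𝒜 h𝒜 => measurable_dualError_state hf hG h𝒜 i) (hz i),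
    mul_zero, mul_zero, add_zero]

theorem meanLE_consensusNoise (hN : 0 < N) (hτ : 0 < τ)
    (h : IsBoundedNoise μ W f G τ α β x₀ y₀ ξ σ)
    (hf : IsSmoothObjective f L) (Q : Fin N → Fin N → ℝ) (d : Fin N → ℝ) (r : ℕ) :
    MeanLE μ (fun ω => consensusNoise Q d (fun i => ∇ (f i)) τ α
        (fun t i => noise W f G τ α β x₀ y₀ ξ r t i ω)
        (state W G τ α β x₀ y₀ (path ξ ω) r).1 (state W G τ α β x₀ y₀ (path ξ ω) r).2)
      (4 * α ^ 2 * τ * N * σ ^ 2) := by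
  have hτR : (0 : ℝ) < τ := by exact_mod_cast hτ
  have hNR : (1 : ℝ) ≤ N := by exact_mod_cast hN
  have hlin := h.lyapunovNoise_mean hf Q d r
  have h1 := (((h.meanLE_accNoise hf r le_rfl).const_mul zero_le_two).add
    ((MeanLE.sum (Finset.range τ) fun t ht => h.meanLE_accNoise hf r
      (Finset.mem_range.1 ht).le).const_mul (show 0 ≤ 1 / (τ : ℝ) by positivity))).add
    ((h.meanLE_norm_sum_avg hN hf r).const_mul (show (0 : ℝ) ≤ N by positivity))
  refine ((h1.const_mul (sq_nonneg α)).sub_const_mul hlin.1 hlin.2 α).mono ?_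
  rw [Finset.sum_const, Finset.card_range, nsmul_eq_mul]
  have e : α ^ 2 * (2 * (N * (τ * σ ^ 2)) + 1 / (τ : ℝ) * (τ * (N * (τ * σ ^ 2)))
      + N * (τ * σ ^ 2 / N)) = 3 * α ^ 2 * τ * N * σ ^ 2 + α ^ 2 * τ * 1 * σ ^ 2 := by
    field_simp
    ring
  rw [e]
  -- The averaged noise contributes no factor `N`; `N ≥ 1` merges it with the other three units.
  have : α ^ 2 * τ * 1 * σ ^ 2 ≤ α ^ 2 * τ * N * σ ^ 2 := by gcongr
  linarith

theorem meanLE_descentNoise (hN : 0 < N) (hα : 0 < α)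
    (h : IsBoundedNoise μ W f G τ α β x₀ y₀ ξ σ) (hf : IsSmoothObjective f L) (r : ℕ) :
    MeanLE μ (fun ω => descentNoise (fun i => ∇ (f i)) L τ α
        (fun t i => noise W f G τ α β x₀ y₀ ξ r t i ω)
        (state W G τ α β x₀ y₀ (path ξ ω) r).1)
      (5 * α ^ 3 * L ^ 2 * τ ^ 2 * σ ^ 2 + L * α ^ 2 * τ * σ ^ 2 / N) := by
  have hNR : (0 : ℝ) < N := by exact_mod_cast hN
  have hL := hf.pos
  have hG := h.measurable_grad
  have hg : MemLp (fun ω => avg fun i =>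
      ∇ (f i) (avg (state W G τ α β x₀ y₀ (path ξ ω) r).1)) 2 μ :=
    memLp_avg fun i => hf.memLp_gradient i (memLp_avg (h.memLp_iterates hf r).1)
  have hs : ∀ t ∈ Finset.range τ,
      MemLp (fun ω => avg fun i => noise W f G τ α β x₀ y₀ ξ r t i ω) 2 μ :=
    fun t ht => memLp_avg fun i => h.memLp r t i (Finset.mem_range.1 ht)
  have hint := integrable_inner_of_memLp hg (memLp_finsetSum _ hs)
  have h0 : ∫ ω, inner ℝ (avg fun i => ∇ (f i) (avg (state W G τ α β x₀ y₀ (path ξ ω) r).1))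
      (∑ t ∈ Finset.range τ, avg fun i => noise W f G τ α β x₀ y₀ ξ r t i ω) ∂μ = 0 := by
    simp_rw [inner_sum]
    rw [integral_finsetSum _ fun t ht => integrable_inner_of_memLp hg (hs t ht)]
    refine Finset.sum_eq_zero fun t ht => ?_
    have ht' := Finset.mem_range.1 ht
    have e : ∀ ω, inner ℝ (avg fun i => ∇ (f i) (avg (state W G τ α β x₀ y₀ (path ξ ω) r).1))
        (avg fun i => noise W f G τ α β x₀ y₀ ξ r t i ω)
        = 1 / (N : ℝ) * ∑ j, inner ℝ
          (avg fun i => ∇ (f i) (avg (state W G τ α β x₀ y₀ (path ξ ω) r).1))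
          (noise W f G τ α β x₀ y₀ ξ r t j ω) := by
      intro ω
      rw [avg.eq_def fun i => noise W f G τ α β x₀ y₀ ξ r t i ω, real_inner_smul_right, inner_sum]
    simp_rw [e]
    rw [integral_const_mul, integral_finsetSum _ fun j _ =>
      integrable_inner_of_memLp hg (h.memLp r t j ht')]
    refine mul_eq_zero_of_right _ (Finset.sum_eq_zero fun j _ => ?_)
    exact h.integral_inner_before_eq_zero hf ht' j (fun 𝒜 h𝒜 => measurable_avg fun i =>
      (hf.continuous_gradient i).measurable.comp (measurable_avg fun k =>
        (measurable_state hG h𝒜 k).1)) hg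
  have h1 := ((MeanLE.sum (Finset.range τ) fun t ht => h.meanLE_accNoise hf r
      (Finset.mem_range.1 ht).le).const_mul (show 0 ≤ 5 * α ^ 3 * L ^ 2 / N by positivity)).add
    ((h.meanLE_norm_sum_avg hN hf r).const_mul (show 0 ≤ L * α ^ 2 by positivity))
  refine (h1.sub_const_mul hint h0 α).mono (le_of_eq ?_)
  rw [Finset.sum_const, Finset.card_range, nsmul_eq_mul]
  field_simp

theorem integrable_errorTerm (h : IsBoundedNoise μ W f G τ α β x₀ y₀ ξ σ)
    (hf : IsSmoothObjective f L) (r : ℕ) :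
    Integrable (fun ω => errorTerm W f G τ α β x₀ y₀ (path ξ ω) r) μ := by
  obtain ⟨hx, -, hφ⟩ := h.memLp_iterates hf r
  simp only [errorTerm, gradient_aggregate hf.differentiable]
  refine Integrable.add ?_ (Integrable.const_mul (integrable_finsetSum _ fun t ht => ?_) _)
  · exact (memLp_avg fun i => hf.memLp_gradient i (memLp_avg hx)).integrable_norm_pow
      (p := 2) two_ne_zero
  · exact (memLp_avg fun i => hf.memLp_gradient i
      (hφ t (Finset.mem_range.1 ht).le i)).integrable_norm_pow (p := 2) two_ne_zero

/-- The integrated form of the pathwise bound. -/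
theorem sum_integral_errorTerm_le (hN : 0 < N) (hτ : 0 < τ) (hW : IsWeightMatrix W)
    (hlam : mixingRate W < 1) (hf : IsSmoothObjective f L)
    (hy : (∀ i, y₀ i = x₀ i - ∑ j, W i j • x₀ j) ∨ (∀ i, y₀ i = 0))
    (hβ : β = 1 / (τ : ℝ)) (hα : 0 < α) (hA : α * τ * L ≤ (1 - mixingRate W) / 32)
    (h : IsBoundedNoise μ W f G τ α β x₀ y₀ ξ σ) (R : ℕ) :
    α * τ / 8 * ∑ r ∈ Finset.range R, ∫ ω, errorTerm W f G τ α β x₀ y₀ (path ξ ω) r ∂μ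
      ≤ aggregate f (avg x₀) - (⨅ z, aggregate f z)
        + 80 * α * τ * L ^ 2 / (N * (1 - mixingRate W))
          * (2 * disagreement x₀
            + 2 / (1 - mixingRate W) * (α ^ 2 * τ ^ 2 * (N * heterogeneity f (avg x₀)))
            + R * (4 * α ^ 2 * τ * N * σ ^ 2))
        + R * (5 * α ^ 3 * L ^ 2 * τ ^ 2 * σ ^ 2 + L * α ^ 2 * τ * σ ^ 2 / N) := by
  have hNR : (0 : ℝ) < N := by exact_mod_cast hN
  have hδ : 0 < 1 - mixingRate W := by linarith
  obtain ⟨Q, d, hQ⟩ := hW.exists_isSpectralBasis hN hlam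
  obtain ⟨-, -, hcol⟩ := mem_doublyStochastic_iff_sum.1 hW.doublyStochastic
  have hy0 : ∑ i, y₀ i = 0 := by
    rcases hy with hy | hy
    · simp_rw [hy, Finset.sum_sub_distrib]
      rw [Finset.sum_comm]
      simp_rw [← Finset.sum_smul, hcol, one_smul, sub_self]
    · simp [hy]
  have hpath : ∀ ω, α * τ / 8 * ∑ r ∈ Finset.range R,
        errorTerm W f G τ α β x₀ y₀ (path ξ ω) r
      ≤ aggregate f (avg x₀) - (⨅ z, aggregate f z)
        + 80 * α * τ * L ^ 2 / (N * (1 - mixingRate W))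
          * (lyapunov Q d (fun i => ∇ (f i)) τ α x₀ y₀
            + ∑ r ∈ Finset.range R, consensusNoise Q d (fun i => ∇ (f i)) τ α
              (fun t i => noise W f G τ α β x₀ y₀ ξ r t i ω)
              (state W G τ α β x₀ y₀ (path ξ ω) r).1 (state W G τ α β x₀ y₀ (path ξ ω) r).2)
        + ∑ r ∈ Finset.range R, descentNoise (fun i => ∇ (f i)) L τ α
            (fun t i => noise W f G τ α β x₀ y₀ ξ r t i ω)
            (state W G τ α β x₀ y₀ (path ξ ω) r).1 := by
    intro ω
    have hs := sum_stationarity_le hN hW hQ hlam hτ hα hf hA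
      (x := fun r => (state W G τ α β x₀ y₀ (path ξ ω) r).1)
      (y := fun r => (state W G τ α β x₀ y₀ (path ξ ω) r).2)
      (isRound (ξ := ξ) (G := G) (f := f) hW hβ hy0 ω) R
    have e : ∀ r, errorTerm W f G τ α β x₀ y₀ (path ξ ω) r
        = stationarity (fun i => ∇ (f i)) τ (phi W G τ α β x₀ y₀ (path ξ ω) r)
          (state W G τ α β x₀ y₀ (path ξ ω) r).1 := by
      intro r
      rw [errorTerm, gradient_aggregate hf.differentiable]
      rfl
    simp_rw [e]
    exact hs
  have hrhs := ((MeanLE.const (μ := μ) (aggregate f (avg x₀) - (⨅ z, aggregate f z))).add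
    (((MeanLE.const (lyapunov Q d (fun i => ∇ (f i)) τ α x₀ y₀)).add
      (MeanLE.sum (Finset.range R) fun r _ => h.meanLE_consensusNoise hN hτ hf Q d r)).const_mul
        (show 0 ≤ 80 * α * τ * L ^ 2 / (N * (1 - mixingRate W)) by positivity))).add
    (MeanLE.sum (Finset.range R) fun r _ => h.meanLE_descentNoise hN hα hf r)
  have hlhs : Integrable (fun ω => α * τ / 8 * ∑ r ∈ Finset.range R,
      errorTerm W f G τ α β x₀ y₀ (path ξ ω) r) μ :=
    (integrable_finsetSum _ fun r _ => h.integrable_errorTerm hf r).const_mul _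
  have hmain := (integral_mono hlhs hrhs.1 hpath).trans hrhs.2
  rw [integral_const_mul, integral_finsetSum _ fun r _ => h.integrable_errorTerm hf r,
    Finset.sum_const, Finset.sum_const, Finset.card_range, nsmul_eq_mul, nsmul_eq_mul] at hmain
  refine hmain.trans ?_
  have hinit := lyapunov_initial_le (α := α) (τ := τ) hN hQ hlam hf.differentiable hy
  gcongr

end IsBoundedNoise
end Noise

/-! ### From the integrated bound to the stated rate -/

theorem le_rate_of_sum_le {N m τ : ℕ} {W : Matrix (Fin N) (Fin N) ℝ} {f : Fin N → Vec m → ℝ}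
    {L σ α : ℝ} {x₀ : Fin N → Vec m} (hN : 0 < N) (hτ : 0 < τ) (hW : IsWeightMatrix W)
    (hlam : mixingRate W < 1) (hf : IsSmoothObjective f L) (hα : 0 < α) {R : ℕ} (hR : 0 < R)
    {S : ℝ}
    (hS : α * τ / 8 * S ≤ aggregate f (avg x₀) - (⨅ z, aggregate f z)
        + 80 * α * τ * L ^ 2 / (N * (1 - mixingRate W))
          * (2 * disagreement x₀
            + 2 / (1 - mixingRate W) * (α ^ 2 * τ ^ 2 * (N * heterogeneity f (avg x₀)))
            + R * (4 * α ^ 2 * τ * N * σ ^ 2))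
        + R * (5 * α ^ 3 * L ^ 2 * τ ^ 2 * σ ^ 2 + L * α ^ 2 * τ * σ ^ 2 / N)) :
    1 / (R : ℝ) * S ≤ 3000 * (rate W f L σ τ α x₀ R
      + L ^ 2 * disagreement x₀ / ((1 - mixingRate W) * minEigenvalue W * N * R)) := by
  have hNR : (0 : ℝ) < N := by exact_mod_cast hN
  have hτR : (0 : ℝ) < τ := by exact_mod_cast hτ
  have hRR : (0 : ℝ) < R := by exact_mod_cast hR
  have hL := hf.pos
  have hδ : 0 < 1 - mixingRate W := by linarith
  have hδ1 : 1 - mixingRate W ≤ 1 := by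
    have : 0 ≤ mixingRate W := norm_nonneg _
    linarith
  have he0 := hW.minEigenvalue_pos hN
  have he1 := hW.minEigenvalue_le_one hN
  have hΔ : 0 ≤ aggregate f (avg x₀) - (⨅ z, aggregate f z) :=
    sub_nonneg.2 (ciInf_le hf.bddBelow _)
  have hdis : 0 ≤ disagreement x₀ := Finset.sum_nonneg fun _ _ => sq_nonneg _
  have hhet : 0 ≤ heterogeneity f (avg x₀) :=
    mul_nonneg (by positivity) (Finset.sum_nonneg fun _ _ => sq_nonneg _)
  rw [rate]
  set Δ := aggregate f (avg x₀) - (⨅ z, aggregate f z)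
  set D := disagreement x₀
  set H := heterogeneity f (avg x₀)
  set δ := 1 - mixingRate W
  set e := minEigenvalue W
  clear_value Δ D H δ e
  have h1 := mul_le_mul_of_nonneg_left hS (show 0 ≤ 8 / (α * τ * R) by positivity)
  have e1 : 8 / (α * τ * R) * (α * τ / 8 * S) = 1 / (R : ℝ) * S := by field_simp
  have e2 : 8 / (α * τ * R) * (Δ + 80 * α * τ * L ^ 2 / (N * δ)
        * (2 * D + 2 / δ * (α ^ 2 * τ ^ 2 * (N * H)) + R * (4 * α ^ 2 * τ * N * σ ^ 2))
        + R * (5 * α ^ 3 * L ^ 2 * τ ^ 2 * σ ^ 2 + L * α ^ 2 * τ * σ ^ 2 / N))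
      = 8 * (Δ / (α * τ * R)) + 1280 * (L ^ 2 * D / (δ * 1 * N * R))
        + 1280 * (α ^ 2 * τ ^ 2 * L ^ 2 * H / (δ ^ 2 * R))
        + 2560 * (α ^ 2 * τ * L ^ 2 * σ ^ 2 / δ) + 40 * (α ^ 2 * τ * L ^ 2 * σ ^ 2 / 1)
        + 8 * (α * L * σ ^ 2 / N) := by
    field_simp
    ring
  rw [e1, e2] at h1
  -- The smallest eigenvalue enters only here, through its bound by 1.
  have c1 : L ^ 2 * D / (δ * 1 * N * R) ≤ L ^ 2 * D / (δ * e * N * R) := by gcongr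
  have c2 : α ^ 2 * τ * L ^ 2 * σ ^ 2 / 1 ≤ α ^ 2 * τ * L ^ 2 * σ ^ 2 / δ := by gcongr
  have p1 : 0 ≤ Δ / (α * τ * R) := by positivity
  have p2 : 0 ≤ L ^ 2 * D / (δ * e * N * R) := by positivity
  have p3 : 0 ≤ α ^ 2 * τ ^ 2 * L ^ 2 * H / (δ ^ 2 * R) := by positivity
  have p4 : 0 ≤ α ^ 2 * τ * L ^ 2 * σ ^ 2 / δ := by positivity
  have p5 : 0 ≤ α * L * σ ^ 2 / N := by positivity
  -- The largest total coefficient is `2560 + 40 = 2600`, below 3000.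
  linarith

theorem disagreement_eq_zero {N m : ℕ} (hN : 0 < N) {x : Fin N → Vec m}
    (hx : ∀ i j, x i = x j) : disagreement x = 0 := by
  refine Finset.sum_eq_zero fun i _ => ?_
  have : avg x = x i := by
    rw [show x = fun _ => x i from funext fun j => hx j i, avg_const hN]
  simp [this]

end LED

theorem theorem1 :
    -- absolute constants: `c` for the stepsize restriction and `C` for the order symbol
    ∃ c C : ℝ, 0 < c ∧ 0 < C ∧
    ∀ (N m τ : ℕ) (_ : 0 < N) (_ : 0 < τ)
      (W : Matrix (Fin N) (Fin N) ℝ) (_ : LED.IsWeightMatrix W)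
      (f : Fin N → LED.Vec m → ℝ) (L : ℝ) (_ : LED.IsSmoothObjective f L)
      (Ξ : Type*) (_ : MeasurableSpace Ξ)
      (Ω : Type*) (_ : MeasurableSpace Ω) (μ : Measure Ω) (_ : IsProbabilityMeasure μ)
      (G : Fin N → LED.Vec m → Ξ → LED.Vec m) (ξ : ℕ → ℕ → Fin N → Ω → Ξ) (σ : ℝ)
      (x₀ y₀ : Fin N → LED.Vec m)
      (_ : (∀ i, y₀ i = x₀ i - ∑ j, W i j • x₀ j) ∨ (∀ i, y₀ i = 0))
      (α β : ℝ) (_ : β = 1 / (τ : ℝ)) (_ : 0 < α)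
      (_ : α ≤ c * (1 - LED.mixingRate W) / (τ * L))
      (_ : LED.IsBoundedNoise μ W f G τ α β x₀ y₀ ξ σ),
      -- the expectations `𝓔_r` exist
      (∀ r : ℕ, Integrable
        (fun ω => LED.errorTerm W f G τ α β x₀ y₀ (LED.path ξ ω) r) μ) ∧
      -- common initialization
      ((∀ i j, x₀ i = x₀ j) → ∀ R : ℕ, 0 < R →
        (1 / (R : ℝ)) * ∑ r ∈ Finset.range R,
            ∫ ω, LED.errorTerm W f G τ α β x₀ y₀ (LED.path ξ ω) r ∂μ
          ≤ C * LED.rate W f L σ τ α x₀ R) ∧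
      -- arbitrary initialization
      (∀ R : ℕ, 0 < R →
        (1 / (R : ℝ)) * ∑ r ∈ Finset.range R,
            ∫ ω, LED.errorTerm W f G τ α β x₀ y₀ (LED.path ξ ω) r ∂μ
          ≤ C * (LED.rate W f L σ τ α x₀ R
              + L ^ 2 * LED.disagreement x₀
                / ((1 - LED.mixingRate W) * LED.minEigenvalue W * N * R))) := by
  refine ⟨1 / 32, 3000, by norm_num, by norm_num, ?_⟩
  intro N m τ hN hτ W hW f L hf Ξ _ Ω _ μ _ G ξ σ x₀ y₀ hy α β hβ hα hαc h
  have hL := hf.pos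
  have hτR : (0 : ℝ) < τ := by exact_mod_cast hτ
  have hA : α * τ * L ≤ (1 - LED.mixingRate W) / 32 := by
    rw [le_div_iff₀ (by positivity)] at hαc
    linarith
  -- A positive stepsize satisfying the restriction exists only if the mixing rate is below one.
  have hlam : LED.mixingRate W < 1 := by
    have : 0 < α * τ * L := by positivity
    linarith
  have hgen : ∀ R : ℕ, 0 < R →
      (1 / (R : ℝ)) * ∑ r ∈ Finset.range R,
          ∫ ω, LED.errorTerm W f G τ α β x₀ y₀ (LED.path ξ ω) r ∂μ
        ≤ 3000 * (LED.rate W f L σ τ α x₀ R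
            + L ^ 2 * LED.disagreement x₀
              / ((1 - LED.mixingRate W) * LED.minEigenvalue W * N * R)) := fun R hR =>
    LED.le_rate_of_sum_le hN hτ hW hlam hf hα hR
      (h.sum_integral_errorTerm_le hN hτ hW hlam hf hy hβ hα hA R)
  refine ⟨h.integrable_errorTerm hf, fun hx R hR => ?_, hgen⟩
  simpa [LED.disagreement_eq_zero hN hx] using hgen R hR
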